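/- An artin algebra is a ring that is a finitely generated module over some commutative artinian ring mapping to its center. Modules are left modules, $\mathrm{mod}\,\Lambda$ denotes the finitely generated ones, and $\mathrm{End}_\Lambda(X)$ denotes the endomorphism ring acting on $X$ from the right (so $fg$ means first $f$, then $g$). For a ring $\Gamma$, $J_\Gamma$ is its Jacobson radical and $\mathrm{gl.dim}\,\Gamma$ its (left) global dimension. A two-sided ideal $I$ of an artin algebra $\Gamma$ is a heredity ideal if $I^2=I$, $I$ is a finitely generated projective left $\Gamma$-module, and $IJ_\Gamma I=0$. An artin algebra $\Gamma$ is quasi-hereditary if there are $m\ge 0$ and a chain $0=I_m\subseteq I_{m-1}\subseteq\cdots\subseteq I_0=\Gamma$ of two-sided ideals such that $I_{n-1}/I_n$ is a heredity ideal of $\Gamma/I_n$ for every $0<n\le m$. For an artin algebra $\Gamma$ let $0\to\Gamma\to I_0(\Gamma)\to I_1(\Gamma)\to\cdots$ be the minimal injective resolution of the left $\Gamma$-module $\Gamma$. The dominant dimension $\mathrm{dom.dim}\,\Gamma$ is the least $i\ge 0$ such that $I_i(\Gamma)$ is not projective ($\infty$ if there is none). The representation dimension of an artin algebra $\Lambda$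 is $$\mathrm{rep.dim}\,\Lambda:=\inf_\Gamma\ \mathrm{gl.dim}\,\Gamma,$$ where $\Gamma$ runs over all artin algebras with $\mathrm{dom.dim}\,\Gamma\ge 2$ such that $\mathrm{End}_\Gamma(I_0(\Gamma))$ is Morita equivalent to $\Lambda$. Theorem. Let $\Lambda$ be an artin algebra. (1) For every $M\in\mathrm{mod}\,\Lambda$ there exists $N\in\mathrm{mod}\,\Lambda$ such that $\mathrm{End}_\Lambda(M\oplus N)$ is a quasi-hereditary algebra. (2) $\mathrm{rep.dim}\,\Lambda<\infty$. -/

import Mathlib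

open CategoryTheory

universe u v

/-- A ring `Λ` is an artin algebra if it is a module-finite algebra over some commutative
artinian ring. (Replacing the base ring by its image in `Λ`, it may be taken in the universe
of `Λ`.) -/
def IsArtinAlgebra (Λ : Type u) [Ring Λ] : Prop :=
  ∃ (R : Type u) (_ : CommRing R) (_ : Algebra R Λ), IsArtinianRing R ∧ Module.Finite R Λ

/-- A heredity ideal: a two-sided ideal `I` with `I² = I`, finitely generated projective as a
left module, and with `I J I = 0`, where `J` is the Jacobson radical. -/
structure IsHeredityIdeal {Λ : Type u} [Ring Λ] (I : Ideal Λ) : Prop where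
  isTwoSided : I.IsTwoSided
  mul_self : I * I = I
  finite : Module.Finite Λ I
  projective : Module.Projective Λ I
  mul_jacobson_mul : I * Ring.jacobson Λ * I = ⊥

/-- A quasi-hereditary algebra: an artin algebra with a chain
`0 = I_m ⊆ I_{m-1} ⊆ ⋯ ⊆ I_0 = Λ` of two-sided ideals such that `I_n / I_{n+1}` is a heredity
ideal of `Λ / I_{n+1}` for all `n < m`. (Terms beyond the index `m` play no role.) -/
def IsQuasiHereditary (Λ : Type u) [Ring Λ] : Prop :=
  IsArtinAlgebra Λ ∧
    ∃ (m : ℕ) (I : ℕ → Ideal Λ) (_ : ∀ n, (I n).IsTwoSided),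
      I 0 = ⊤ ∧ I m = ⊥ ∧
        ∀ n < m, I (n + 1) ≤ I n ∧
          IsHeredityIdeal ((I n).map (Ideal.Quotient.mk (I (n + 1))))

/-- The (left) global dimension: the supremum of the projective dimensions of all left modules,
with values in `{-∞} ∪ ℕ ∪ {∞}` (the zero module has projective dimension `-∞`). -/
noncomputable def globalDimension (Γ : Type u) [Ring Γ] : WithBot ℕ∞ :=
  ⨆ X : ModuleCat.{u} Γ, projectiveDimension X

/-- A submodule is essential if it meets every nonzero submodule nontrivially. -/
def IsEssentialSubmodule {Γ : Type u} [Ring Γ] {X : Type v} [AddCommGroup X] [Module Γ X]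
    (U : Submodule Γ X) : Prop :=
  ∀ V : Submodule Γ X, U ⊓ V = ⊥ → V = ⊥

/-- A minimal injective resolution `0 → Γ → I 0 → I 1 → I 2 → ⋯` of the left module `Γ`: an exact
sequence with injective terms, each of which is an injective hull of the image of the preceding
map. It is unique up to isomorphism. -/
structure MinimalInjectiveResolution (Γ : Type u) [Ring Γ] where
  I : ℕ → ModuleCat.{u} Γ
  ι : Γ →ₗ[Γ] I 0
  d : ∀ n, I n →ₗ[Γ] I (n + 1)
  injective : ∀ n, Module.Injective Γ (I n)
  ι_injective : Function.Injective ι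
  exact_zero : Function.Exact ι (d 0)
  exact_succ : ∀ n, Function.Exact (d n) (d (n + 1))
  essential_zero : IsEssentialSubmodule (LinearMap.range ι)
  essential_succ : ∀ n, IsEssentialSubmodule (LinearMap.range (d n))

/-- The dominant dimension read off from a minimal injective resolution of `Γ`: the least `i` such
that `I i` is not projective, and `∞` if there is none. -/
noncomputable def MinimalInjectiveResolution.dominantDimension {Γ : Type u} [Ring Γ]
    (E : MinimalInjectiveResolution Γ) : ℕ∞ :=
  ⨅ (i : ℕ) (_ : ¬ Module.Projective Γ (E.I i)), (i : ℕ∞)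

/-- The representation dimension: the infimum of `gl.dim Γ` over all artin algebras `Γ` with
dominant dimension at least two such that the endomorphism ring of the injective hull `I 0` of the
left module `Γ` is Morita equivalent (as a ring) to `Λ`. Endomorphisms of left modules act from the
right, so the endomorphism ring is the opposite of `Module.End`. -/
noncomputable def repDim (Λ : Type u) [Ring Λ] : WithBot ℕ∞ :=
  sInf {d | ∃ (Γ : Type u) (_ : Ring Γ) (E : MinimalInjectiveResolution Γ),
    IsArtinAlgebra Γ ∧ 2 ≤ E.dominantDimension ∧
      IsMoritaEquivalent ℤ (Module.End Γ (E.I 0))ᵐᵒᵖ Λ ∧ d = globalDimension Γ}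

/-! Put M_0 = M and let M_{i+1} be M_i multiplied by the radical of its endomorphism ring. That
radical is nilpotent, so lengths drop strictly and some M_m is 0. Let L be the sum of all M_i, U_n
the sum of the M_i with i ≥ n, and Γ = End(L). The ideals I_n of endomorphisms with image in the
trace of U_n form the chain.

The crux is `isInAdd_traceIn_radIn`: the trace of M_{i+1} in M_i lies in add M_{i+1}. Hence the
trace of U_n in L lies in add U_n, which makes I_n idempotent and projective over Γ itself. Radical
endomorphisms of U_n land in the trace of U_{n+1}, so I_n J I_n ≤ I_{n+1}. Such a chain makes Γ
quasi-hereditary, and projectivity over Γ bounds the global dimension by its length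
(`IsProjectiveHeredityChain.hasProjectiveDimensionLT`).

For the representation dimension, start from M = Λ ⊕ W, where W is the dual of Λ, an injective
cogenerator with End(W) = Λ. Then Hom(L, -) is fully faithful and preserves injectives and essential
images. It carries a minimal injective copresentation of L with terms in add W to one of Γ, whose
terms are projective because W lies in add L; so the dominant dimension is at least 2. A complement
is added to L so that its hull is a full power of W; the endomorphism ring of that power is a matrix
ring over Λ. -/

/-- A chain of idempotent two-sided ideals, projective as left modules, from the whole ring down to
zero, such that each subquotient `I n / I (n + 1)` satisfies the radical condition of heredity
ideals. -/
structure IsProjectiveHeredityChain {Γ : Type u} [Ring Γ] (I : ℕ → Ideal Γ) (m : ℕ) : Prop where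
  isTwoSided : ∀ n, (I n).IsTwoSided
  zero : I 0 = ⊤
  last : I m = ⊥
  succ_le : ∀ n, I (n + 1) ≤ I n
  mul_self : ∀ n, I n * I n = I n
  projective : ∀ n, Module.Projective Γ (I n)
  mul_jacobson_mul : ∀ n, I n * Ring.jacobson Γ * I n ≤ I (n + 1)

/-! ### Radicals and heredity ideals in quotient rings -/

section Semiprimary

variable {Γ : Type u} [Ring Γ]

theorem map_quotient_mk_mul (K I J : Ideal Γ) [K.IsTwoSided] :
    (I * J).map (Ideal.Quotient.mk K) =
      I.map (Ideal.Quotient.mk K) * J.map (Ideal.Quotient.mk K) := by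
  refine le_antisymm ?_ (Ideal.mul_le.mpr fun r hr s hs ↦ ?_)
  · refine Ideal.map_le_iff_le_comap.mpr (Ideal.mul_le.mpr fun r hr s hs ↦ ?_)
    rw [Ideal.mem_comap, map_mul]
    exact Ideal.mul_mem_mul (Ideal.mem_map_of_mem _ hr) (Ideal.mem_map_of_mem _ hs)
  · obtain ⟨r, hr', rfl⟩ :=
      (Ideal.mem_map_iff_of_surjective _ Ideal.Quotient.mk_surjective).mp hr
    obtain ⟨s, hs', rfl⟩ :=
      (Ideal.mem_map_iff_of_surjective _ Ideal.Quotient.mk_surjective).mp hs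
    rw [← map_mul]
    exact Ideal.mem_map_of_mem _ (Ideal.mul_mem_mul hr' hs')

theorem projective_finsupp {ι P : Type*} [AddCommGroup P] [Module Γ P] [Module.Projective Γ P] :
    Module.Projective Γ (ι →₀ P) := by
  classical
  exact Module.Projective.of_equiv (finsuppLequivDFinsupp Γ (M := P) (ι := ι)).symm

/-- Modulo the image of the radical of Γ, the ring Γ/I becomes a quotient of the semisimple ring
Γ/J, so its radical vanishes there. -/
theorem jacobson_quotient_le_map [IsArtinianRing Γ] (I : Ideal Γ) [I.IsTwoSided] :
    Ring.jacobson (Γ ⧸ I) ≤ (Ring.jacobson Γ).map (Ideal.Quotient.mk I) := by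
  have h2 : ((Ring.jacobson Γ).map (Ideal.Quotient.mk I)).IsTwoSided := inferInstance
  apply Ring.jacobson_le_of_eq_bot
  have : IsSemisimpleRing ((Γ ⧸ I) ⧸ (Ring.jacobson Γ).map (Ideal.Quotient.mk I)) := by
    let f : Γ ⧸ Ring.jacobson Γ →+* (Γ ⧸ I) ⧸ (Ring.jacobson Γ).map (Ideal.Quotient.mk I) :=
      Ideal.Quotient.lift _ ((Ideal.Quotient.mk _).comp (Ideal.Quotient.mk I)) fun a ha ↦
        Ideal.Quotient.eq_zero_iff_mem.mpr (Ideal.mem_map_of_mem _ ha)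
    refine RingHom.isSemisimpleRing_of_surjective f fun x ↦ ?_
    obtain ⟨x, rfl⟩ := Ideal.Quotient.mk_surjective x
    obtain ⟨x, rfl⟩ := Ideal.Quotient.mk_surjective x
    exact ⟨Ideal.Quotient.mk _ x, rfl⟩
  exact IsSemisimpleRing.jacobson_eq_bot _

theorem isSemisimpleModule_of_jacobson_smul_eq_zero [IsArtinianRing Γ] {X : Type v}
    [AddCommGroup X] [Module Γ X] (h : ∀ a ∈ Ring.jacobson Γ, ∀ x : X, a • x = 0) :
    IsSemisimpleModule Γ X := by
  have hT : Module.IsTorsionBySet Γ X (Ring.jacobson Γ) := fun x a ↦ h a.1 a.2 x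
  let : Module (Γ ⧸ Ring.jacobson Γ) X := hT.module
  let e : X →ₛₗ[Ideal.Quotient.mk (Ring.jacobson Γ)] X :=
    { AddMonoidHom.id X with map_smul' := fun a x ↦ (hT.mk_smul a x).symm }
  have : RingHomSurjective (Ideal.Quotient.mk (Ring.jacobson Γ)) := inferInstance
  rw [e.isSemisimpleModule_iff_of_bijective Function.bijective_id]
  infer_instance

/-- If `K ≤ I` are two-sided ideals with `K` idempotent and `I` projective, then `I / K` is
projective over the quotient ring. -/
theorem projective_map_quotient (I K : Ideal Γ) [K.IsTwoSided] (hle : K ≤ I) (hK : K * K = K)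
    [Module.Projective Γ I] : Module.Projective (Γ ⧸ K) (I.map (Ideal.Quotient.mk K)) := by
  let π : I →ₛₗ[Ideal.Quotient.mk K] I.map (Ideal.Quotient.mk K) :=
    { toFun := fun x ↦ ⟨Ideal.Quotient.mk K x, Ideal.mem_map_of_mem _ x.2⟩
      map_add' := fun x y ↦ by ext; simp
      map_smul' := fun a x ↦ by ext; simp }
  have hπ : Function.Surjective π := by
    rintro ⟨y, hy⟩
    obtain ⟨x, hx, rfl⟩ :=
      (Ideal.mem_map_iff_of_surjective _ Ideal.Quotient.mk_surjective).mp hy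
    exact ⟨⟨x, hx⟩, rfl⟩
  refine Module.Projective.of_lifting_property'' fun f hf ↦ ?_
  let A := (I.map (Ideal.Quotient.mk K)) →₀ (Γ ⧸ K)
  let : Module Γ A := Module.compHom A (Ideal.Quotient.mk K)
  let : Module Γ (I.map (Ideal.Quotient.mk K)) := Module.compHom _ (Ideal.Quotient.mk K)
  let f' : A →ₗ[Γ] I.map (Ideal.Quotient.mk K) :=
    { f with map_smul' := fun a x ↦ f.map_smul (Ideal.Quotient.mk K a) x }
  let π' : I →ₗ[Γ] I.map (Ideal.Quotient.mk K) :=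
    { π with map_smul' := fun a x ↦ π.map_smulₛₗ a x }
  obtain ⟨s, hs⟩ := Module.projective_lifting_property f' π' hf
  have hs' (x : I) : f (s x) = π x := LinearMap.congr_fun hs x
  have hker (x : I) (hx : π x = 0) : s x = 0 := by
    have hxK : (x : Γ) ∈ K * K := by
      rw [hK, ← Ideal.Quotient.eq_zero_iff_mem]
      exact congrArg Subtype.val hx
    -- A Γ-map into a module killed by K vanishes on K·K = K, since s(ab) = a s(b) = 0. Thus the
    -- lift s descends from I to I/K.
    have key : ∀ y ∈ K * K, ∃ hy : y ∈ I, s ⟨y, hy⟩ = 0 := by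
      intro y hy
      refine Submodule.smul_induction_on (p := fun y ↦ ∃ hy : y ∈ I, s ⟨y, hy⟩ = 0) hy ?_ ?_
      · intro a ha b hb
        refine ⟨I.smul_mem a (hle hb), ?_⟩
        have h1 : (⟨a • b, I.smul_mem a (hle hb)⟩ : I) = a • ⟨b, hle hb⟩ := rfl
        rw [h1, map_smul]
        change Ideal.Quotient.mk K a • s ⟨b, hle hb⟩ = 0
        rw [Ideal.Quotient.eq_zero_iff_mem.mpr ha, zero_smul]
      · rintro a b ⟨ha, h1⟩ ⟨hb, h2⟩
        refine ⟨add_mem ha hb, ?_⟩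
        have h5 : (⟨a + b, add_mem ha hb⟩ : I) = ⟨a, ha⟩ + ⟨b, hb⟩ := rfl
        rw [h5, map_add, h1, h2, add_zero]
    exact (key x hxK).2
  have hwd (x y : I) (h : π x = π y) : s x = s y := by
    rw [← sub_eq_zero, ← map_sub]
    exact hker _ (by rw [map_sub, h, sub_self])
  have hsec := Function.rightInverse_surjInv hπ
  refine ⟨{ toFun := fun x ↦ s (Function.surjInv hπ x)
            map_add' := fun x y ↦ ?_
            map_smul' := fun a x ↦ ?_ }, ?_⟩
  · rw [← map_add]
    exact hwd _ _ (by rw [map_add, hsec, hsec, hsec])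
  · obtain ⟨a, rfl⟩ := Ideal.Quotient.mk_surjective a
    change _ = a • s _
    rw [← map_smul]
    exact hwd _ _ (by rw [map_smulₛₗ, hsec, hsec])
  · ext x : 1
    exact (hs' _).trans (hsec x)

theorem IsProjectiveHeredityChain.isHeredityIdeal [IsArtinianRing Γ] {I : ℕ → Ideal Γ} {m : ℕ}
    (h : IsProjectiveHeredityChain I m) (n : ℕ) [(I (n + 1)).IsTwoSided] :
    IsHeredityIdeal ((I n).map (Ideal.Quotient.mk (I (n + 1)))) := by
  have := h.isTwoSided n
  have := h.projective n
  refine ⟨inferInstance, ?_, ?_, projective_map_quotient _ _ (h.succ_le n) (h.mul_self _), ?_⟩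
  · rw [← map_quotient_mk_mul, h.mul_self]
  · have : IsNoetherianRing (Γ ⧸ I (n + 1)) := inferInstance
    infer_instance
  · rw [eq_bot_iff]
    refine (Ideal.mul_mono_left (Ideal.mul_mono_right (jacobson_quotient_le_map _))).trans ?_
    rw [← map_quotient_mk_mul, ← map_quotient_mk_mul]
    exact (Ideal.map_mk_eq_bot_of_le (h.mul_jacobson_mul n)).le

theorem IsProjectiveHeredityChain.isQuasiHereditary [IsArtinianRing Γ] (hΓ : IsArtinAlgebra Γ)
    {I : ℕ → Ideal Γ} {m : ℕ} (h : IsProjectiveHeredityChain I m) : IsQuasiHereditary Γ :=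
  ⟨hΓ, m, I, h.isTwoSided, h.zero, h.last, fun n _ ↦
    have := h.isTwoSided (n + 1)
    ⟨h.succ_le n, h.isHeredityIdeal n⟩⟩

end Semiprimary

/-! ### Global dimension bound from a projective heredity chain -/

section ProjectiveDimension

variable {Γ : Type u} [Ring Γ]

theorem shortExact_submodule {X : Type u} [AddCommGroup X] [Module Γ X] (K : Submodule Γ X) :
    (ModuleCat.shortComplexOfCompEqZero K.subtype K.mkQ (by ext; simp)).ShortExact :=
  ModuleCat.shortComplex_shortExact _ (LinearMap.exact_subtype_mkQ K) K.injective_subtype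
    K.mkQ_surjective

/-- Induction on n gives projective dimension at most n for modules killed by I_n. For X killed by
I_{n+1}, both X/I_nX and the radical part J·I_nX are killed by I_n, the latter because I_n J I_n ≤
I_{n+1}. What remains is a semisimple module generated by I_n. -/
theorem IsProjectiveHeredityChain.hasProjectiveDimensionLT [IsArtinianRing Γ] {I : ℕ → Ideal Γ}
    {m : ℕ} (h : IsProjectiveHeredityChain I m) (n : ℕ) :
    ∀ (X : Type u) [AddCommGroup X] [Module Γ X], (∀ a ∈ I n, ∀ x : X, a • x = 0) →
      HasProjectiveDimensionLT (ModuleCat.of Γ X) (n + 1) := by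
  induction n with
  | zero =>
    intro X _ _ hX
    have : Subsingleton X := subsingleton_of_forall_eq 0 fun x ↦ by
      rw [← one_smul Γ x]; exact hX 1 (h.zero ▸ Submodule.mem_top) x
    have := (ModuleCat.isZero_of_subsingleton (ModuleCat.of Γ X)).hasProjectiveDimensionLT_zero
    infer_instance
  | succ n ih =>
    have := h.isTwoSided n
    have := h.isTwoSided (n + 1)
    have hproj := h.projective n
    have hproj' := h.projective (n + 1)
    have hsmul (Y : Type u) [AddCommGroup Y] [Module Γ Y] (hY : ∀ a ∈ I (n + 1), ∀ y : Y, a • y = 0)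
        (a j b : Γ) (ha : a ∈ I n) (hj : j ∈ Ring.jacobson Γ) (hb : b ∈ I n) (y : Y) :
        a • j • b • y = 0 := by
      rw [← mul_smul, ← mul_smul]
      exact hY _ (h.mul_jacobson_mul n (Ideal.mul_mem_mul (Ideal.mul_mem_mul ha hj) hb)) y
    -- semisimple modules generated by `I n`
    have h₁ (Y : Type u) [AddCommGroup Y] [Module Γ Y] (hY : ∀ a ∈ I (n + 1), ∀ y : Y, a • y = 0)
        (hJ : ∀ a ∈ Ring.jacobson Γ, ∀ y : Y, a • y = 0) (hI : I n • (⊤ : Submodule Γ Y) = ⊤) :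
        HasProjectiveDimensionLT (ModuleCat.of Γ Y) (n + 2) := by
      let ψ : (Y →₀ I (n + 1)) →ₗ[Γ] (Y →₀ I n) := Finsupp.mapRange.linearMap
        (Submodule.inclusion (h.succ_le n))
      have hψ : Function.Injective ψ :=
        Finsupp.mapRange_injective _ (map_zero _) (Submodule.inclusion_injective _)
      let φ : (Y →₀ I n) →ₗ[Γ] Y := Finsupp.lsum ℕ fun y ↦
        (LinearMap.toSpanSingleton Γ Y y).comp (I n).subtype
      have hφ (y : Y) (a : I n) : φ (Finsupp.single y a) = (a : Γ) • y := by
        simp only [φ, Finsupp.lsum_single]; rfl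
      have hφs : Function.Surjective φ := by
        rw [← LinearMap.range_eq_top, eq_top_iff, ← hI, Submodule.smul_le]
        intro a ha y _
        exact ⟨Finsupp.single y ⟨a, ha⟩, hφ _ _⟩
      -- Q is a sum of copies of I_n/I_{n+1}, resolved by two projectives, so its projective
      -- dimension is at most 1. This is where projectivity over Γ itself enters.
      let Q := (Y →₀ I n) ⧸ LinearMap.range ψ
      have hQ : HasProjectiveDimensionLT (ModuleCat.of Γ Q) (n + 2) := by
        have : HasProjectiveDimensionLT (ModuleCat.of Γ (LinearMap.range ψ)) 1 := by
          have : Module.Projective Γ (Y →₀ I (n + 1)) := projective_finsupp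
          have : Module.Projective Γ (LinearMap.range ψ) :=
            Module.Projective.of_equiv (LinearEquiv.ofInjective ψ hψ)
          infer_instance
        have hF : HasProjectiveDimensionLT (ModuleCat.of Γ (Y →₀ I n)) 1 := by
          have : Module.Projective Γ (Y →₀ I n) := projective_finsupp
          infer_instance
        have : HasProjectiveDimensionLT (ModuleCat.of Γ Q) 2 :=
          (shortExact_submodule (LinearMap.range ψ)).hasProjectiveDimensionLT_X₃ 1 this
            (hasProjectiveDimensionLT_of_ge _ 1 _ one_le_two)
        exact hasProjectiveDimensionLT_of_ge _ 2 _ (by lia)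
      let JQ : Submodule Γ Q := Ring.jacobson Γ • ⊤
      have hJQ : HasProjectiveDimensionLT (ModuleCat.of Γ JQ) (n + 1) := by
        refine ih JQ fun a ha x ↦ Subtype.ext ?_
        obtain ⟨x, hx⟩ := x
        change a • x = 0
        refine Submodule.smul_induction_on (p := fun x ↦ a • x = 0) hx ?_ ?_
        · intro j hj q _
          obtain ⟨f, rfl⟩ := Submodule.mkQ_surjective _ q
          rw [← map_smul, ← map_smul, Submodule.mkQ_apply, Submodule.Quotient.mk_eq_zero]
          induction f using Finsupp.induction_linear with
          | zero => simp
          | add f g hf hg =>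
            simp only [smul_add]; exact add_mem (hf trivial) (hg trivial)
          | single y b =>
            refine ⟨Finsupp.single y ⟨a * j * b, h.mul_jacobson_mul n
              (Ideal.mul_mem_mul (Ideal.mul_mem_mul ha hj) b.2)⟩, ?_⟩
            simp only [ψ, Finsupp.mapRange.linearMap_apply, Finsupp.mapRange_single,
              Finsupp.smul_single]
            congr 1
            ext
            simp [mul_assoc]
        · intro x y hx hy
          rw [smul_add, hx, hy, add_zero]
      let S := Q ⧸ JQ
      have hS : HasProjectiveDimensionLT (ModuleCat.of Γ S) (n + 2) :=
        (shortExact_submodule JQ).hasProjectiveDimensionLT_X₃ (n + 1) hJQ hQ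
      have hSs : IsSemisimpleModule Γ S := isSemisimpleModule_of_jacobson_smul_eq_zero fun a ha x ↦ by
        obtain ⟨x, rfl⟩ := Submodule.mkQ_surjective _ x
        rw [← map_smul, Submodule.mkQ_apply, Submodule.Quotient.mk_eq_zero]
        exact Submodule.smul_mem_smul ha trivial
      let g₁ : Q →ₗ[Γ] Y := Submodule.liftQ _ φ (by
        rw [LinearMap.range_le_ker_iff]
        ext y a
        have h1 : ψ (Finsupp.single y a) =
            Finsupp.single y (Submodule.inclusion (h.succ_le n) a) :=
          Finsupp.mapRange_single (hf := map_zero _)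
        rw [LinearMap.comp_apply, LinearMap.comp_apply, Finsupp.lsingle_apply, h1, hφ]
        exact hY a a.2 y)
      let g₂ : S →ₗ[Γ] Y := Submodule.liftQ _ g₁ (by
        rw [Submodule.smul_le]
        intro a ha x _
        rw [LinearMap.mem_ker, map_smul]
        exact hJ a ha _)
      have hg₂ : Function.Surjective g₂ := fun y ↦ by
        obtain ⟨f, rfl⟩ := hφs y
        exact ⟨Submodule.Quotient.mk (Submodule.Quotient.mk f), rfl⟩
      -- Q/JQ is semisimple and maps onto Y, so Y is a direct summand of it and inherits its bound.
      obtain ⟨s, hs⟩ := IsSemisimpleModule.lifting_property g₂ hg₂ LinearMap.id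
      exact Retract.hasProjectiveDimensionLT (Y := ModuleCat.of Γ S)
        { i := ModuleCat.ofHom s
          r := ModuleCat.ofHom g₂
          retract := by rw [← ModuleCat.ofHom_comp, hs]; rfl } _
    -- modules generated by `I n`
    have h₂ (Y : Type u) [AddCommGroup Y] [Module Γ Y] (hY : ∀ a ∈ I (n + 1), ∀ y : Y, a • y = 0)
        (hI : I n • (⊤ : Submodule Γ Y) = ⊤) :
        HasProjectiveDimensionLT (ModuleCat.of Γ Y) (n + 2) := by
      let K : Submodule Γ Y := Ring.jacobson Γ • ⊤
      have hK : HasProjectiveDimensionLT (ModuleCat.of Γ K) (n + 1) := by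
        refine ih K fun a ha x ↦ Subtype.ext ?_
        obtain ⟨x, hx⟩ := x
        change a • x = 0
        refine Submodule.smul_induction_on (p := fun x ↦ a • x = 0) hx ?_ ?_
        · intro j hj y _
          have hy : y ∈ I n • (⊤ : Submodule Γ Y) := by rw [hI]; trivial
          refine Submodule.smul_induction_on (p := fun y ↦ a • j • y = 0) hy ?_ ?_
          · exact fun b hb y _ ↦ hsmul Y hY a j b ha hj hb y
          · intro x y hx hy
            rw [smul_add, smul_add, hx, hy, add_zero]
        · intro x y hx hy
          rw [smul_add, hx, hy, add_zero]
      refine (shortExact_submodule K).hasProjectiveDimensionLT_X₂ (n + 2)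
        (hasProjectiveDimensionLT_of_ge (ModuleCat.of Γ K) (n + 1) _ (by lia)) ?_
      refine h₁ (Y ⧸ K) ?_ ?_ ?_
      · intro a ha y
        obtain ⟨y, rfl⟩ := Submodule.mkQ_surjective _ y
        rw [← map_smul, hY a ha, map_zero]
      · intro a ha y
        obtain ⟨y, rfl⟩ := Submodule.mkQ_surjective _ y
        rw [← map_smul, Submodule.mkQ_apply, Submodule.Quotient.mk_eq_zero]
        exact Submodule.smul_mem_smul ha trivial
      · rw [← Submodule.range_mkQ K, LinearMap.range_eq_map, ← Submodule.map_smul'', hI]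
    intro X _ _ hX
    let K : Submodule Γ X := I n • ⊤
    refine (shortExact_submodule K).hasProjectiveDimensionLT_X₂ (n + 2) ?_ ?_
    · refine h₂ K (fun a ha x ↦ Subtype.ext (hX a ha x)) ?_
      apply Submodule.map_injective_of_injective K.injective_subtype
      rw [Submodule.map_smul'', ← LinearMap.range_eq_map, Submodule.range_subtype]
      change I n • (I n • (⊤ : Submodule Γ X)) = I n • ⊤
      rw [← Submodule.mul_smul, h.mul_self]
    · have : HasProjectiveDimensionLT (ModuleCat.of Γ (X ⧸ K)) (n + 1) := by
        refine ih (X ⧸ K) fun a ha y ↦ ?_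
        obtain ⟨y, rfl⟩ := Submodule.mkQ_surjective _ y
        rw [← map_smul, Submodule.mkQ_apply, Submodule.Quotient.mk_eq_zero]
        exact Submodule.smul_mem_smul ha trivial
      exact hasProjectiveDimensionLT_of_ge (ModuleCat.of Γ (X ⧸ K)) (n + 1) _ (by lia)

theorem IsProjectiveHeredityChain.globalDimension_lt_top [IsArtinianRing Γ] {I : ℕ → Ideal Γ}
    {m : ℕ} (h : IsProjectiveHeredityChain I m) : globalDimension Γ < ⊤ := by
  refine lt_of_le_of_lt (b := ((m : ℕ∞) : WithBot ℕ∞)) ?_ ?_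
  · refine iSup_le fun X ↦ ?_
    rw [show ((m : ℕ∞) : WithBot ℕ∞) = ((m : ℕ) : WithBot ℕ∞) from rfl,
      projectiveDimension_le_iff]
    refine h.hasProjectiveDimensionLT m X fun a ha x ↦ ?_
    rw [h.last, Submodule.mem_bot] at ha
    rw [ha, zero_smul]
  · exact WithBot.coe_lt_coe.mpr (ENat.natCast_lt_top m)

end ProjectiveDimension

/-! ### Maps factoring through add B, and membership in add B -/

section FactorsThroughAdd

variable {Λ : Type u} [Ring Λ]
variable {A A' A'' B C : Type*} [AddCommGroup A] [Module Λ A] [AddCommGroup A'] [Module Λ A']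
  [AddCommGroup A''] [Module Λ A''] [AddCommGroup B] [Module Λ B] [AddCommGroup C] [Module Λ C]

/-- A linear map factors through `add B` if it is a finite sum of maps that factor through `B`. -/
def FactorsThroughAdd (B : Type*) [AddCommGroup B] [Module Λ B] (h : A →ₗ[Λ] A') : Prop :=
  ∃ (κ : Type) (_ : Fintype κ) (f : κ → A →ₗ[Λ] B) (g : κ → B →ₗ[Λ] A'), ∑ i, g i ∘ₗ f i = h

theorem FactorsThroughAdd.of_comp (f : A →ₗ[Λ] B) (g : B →ₗ[Λ] A') :
    FactorsThroughAdd B (g ∘ₗ f) :=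
  ⟨Unit, inferInstance, fun _ ↦ f, fun _ ↦ g, by simp⟩

theorem FactorsThroughAdd.zero : FactorsThroughAdd B (0 : A →ₗ[Λ] A') :=
  ⟨Empty, inferInstance, fun _ ↦ 0, fun _ ↦ 0, by simp⟩

theorem FactorsThroughAdd.add {h k : A →ₗ[Λ] A'} (hh : FactorsThroughAdd B h)
    (hk : FactorsThroughAdd B k) : FactorsThroughAdd B (h + k) := by
  obtain ⟨κ, _, f, g, rfl⟩ := hh
  obtain ⟨κ', _, f', g', rfl⟩ := hk
  exact ⟨κ ⊕ κ', inferInstance, Sum.elim f f', Sum.elim g g', by simp⟩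

theorem FactorsThroughAdd.sum {κ : Type*} (s : Finset κ) {h : κ → A →ₗ[Λ] A'}
    (hh : ∀ i ∈ s, FactorsThroughAdd B (h i)) : FactorsThroughAdd B (∑ i ∈ s, h i) :=
  Finset.sum_induction _ _ (fun _ _ ↦ .add) .zero hh

theorem FactorsThroughAdd.comp_left {h : A →ₗ[Λ] A'} (hh : FactorsThroughAdd B h)
    (k : A' →ₗ[Λ] A'') : FactorsThroughAdd B (k ∘ₗ h) := by
  obtain ⟨κ, _, f, g, rfl⟩ := hh
  exact ⟨κ, inferInstance, f, fun i ↦ k ∘ₗ g i, by ext x; simp⟩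

theorem FactorsThroughAdd.comp_right {h : A' →ₗ[Λ] A''} (hh : FactorsThroughAdd B h)
    (k : A →ₗ[Λ] A') : FactorsThroughAdd B (h ∘ₗ k) := by
  obtain ⟨κ, _, f, g, rfl⟩ := hh
  exact ⟨κ, inferInstance, fun i ↦ f i ∘ₗ k, g, by ext x; simp⟩

/-- `A` is a direct summand of a finite direct sum of copies of `B`. -/
def IsInAdd (Λ : Type u) [Ring Λ] (A B : Type*) [AddCommGroup A] [Module Λ A] [AddCommGroup B]
    [Module Λ B] : Prop :=
  FactorsThroughAdd B (LinearMap.id : A →ₗ[Λ] A)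

theorem IsInAdd.of_retract (f : A →ₗ[Λ] B) (g : B →ₗ[Λ] A) (h : g ∘ₗ f = LinearMap.id) :
    IsInAdd Λ A B := by
  rw [IsInAdd, ← h]
  exact .of_comp f g

theorem IsInAdd.of_equiv (e : A ≃ₗ[Λ] B) : IsInAdd Λ A B :=
  .of_retract e.toLinearMap e.symm.toLinearMap (by ext; simp)

theorem IsInAdd.refl : IsInAdd Λ A A := .of_equiv (.refl Λ A)

theorem FactorsThroughAdd.trans {h : A →ₗ[Λ] A'} (hh : FactorsThroughAdd B h)
    (hB : IsInAdd Λ B C) : FactorsThroughAdd C h := by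
  obtain ⟨κ, _, f, g, rfl⟩ := hh
  exact .sum _ fun i _ ↦ by
    simpa using (hB.comp_left (g i)).comp_right (f i)

theorem IsInAdd.trans (hA : IsInAdd Λ A B) (hB : IsInAdd Λ B C) : IsInAdd Λ A C :=
  FactorsThroughAdd.trans hA hB

end FactorsThroughAdd

/-! ### Traces and generation -/

section Trace

variable {Λ : Type u} [Ring Λ]
variable {A A' B C U : Type*} [AddCommGroup A] [Module Λ A] [AddCommGroup A'] [Module Λ A']
  [AddCommGroup B] [Module Λ B] [AddCommGroup C] [Module Λ C] [AddCommGroup U] [Module Λ U]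

/-- The trace of `U` in `A`: the sum of the images of all maps from `U` to `A`. -/
def traceIn (Λ : Type u) [Ring Λ] (U A : Type*) [AddCommGroup U] [Module Λ U] [AddCommGroup A]
    [Module Λ A] : Submodule Λ A :=
  ⨆ f : U →ₗ[Λ] A, LinearMap.range f

theorem apply_mem_traceIn (f : U →ₗ[Λ] A) (x : U) : f x ∈ traceIn Λ U A :=
  Submodule.mem_iSup_of_mem f ⟨x, rfl⟩

theorem traceIn_le {K : Submodule Λ A} : traceIn Λ U A ≤ K ↔ ∀ (f : U →ₗ[Λ] A) x, f x ∈ K := by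
  refine iSup_le_iff.trans (forall_congr' fun f ↦ ?_)
  rw [LinearMap.range_le_iff_comap, Submodule.eq_top_iff']
  rfl

theorem traceIn_le_comap (φ : A →ₗ[Λ] A') : traceIn Λ U A ≤ (traceIn Λ U A').comap φ :=
  traceIn_le.mpr fun f x ↦ apply_mem_traceIn (φ ∘ₗ f) x

theorem apply_mem_traceIn_of_generates (h : traceIn Λ U B = ⊤) (f : B →ₗ[Λ] A) (x : B) :
    f x ∈ traceIn Λ U A :=
  traceIn_le_comap f (h ▸ Submodule.mem_top : x ∈ traceIn Λ U B)

theorem traceIn_le_of_generates (h : traceIn Λ U B = ⊤) : traceIn Λ B A ≤ traceIn Λ U A :=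
  traceIn_le.mpr fun f x ↦ apply_mem_traceIn_of_generates h f x

theorem generates_trans (h : traceIn Λ U B = ⊤) (h' : traceIn Λ B A = ⊤) : traceIn Λ U A = ⊤ :=
  top_le_iff.mp (h' ▸ traceIn_le_of_generates h)

theorem generates_self : traceIn Λ A A = ⊤ :=
  top_le_iff.mp fun x _ ↦ apply_mem_traceIn LinearMap.id x

theorem IsInAdd.generates (h : IsInAdd Λ A B) : traceIn Λ B A = ⊤ := by
  obtain ⟨κ, _, f, g, hfg⟩ := h
  refine top_le_iff.mp fun x _ ↦ ?_
  rw [← LinearMap.id_apply (R := Λ) x, ← hfg, LinearMap.sum_apply]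
  exact sum_mem fun i _ ↦ apply_mem_traceIn (g i) _

theorem generates_prod (hA : traceIn Λ U A = ⊤) (hB : traceIn Λ U B = ⊤) :
    traceIn Λ U (A × B) = ⊤ := by
  refine top_le_iff.mp fun x _ ↦ ?_
  rw [← Prod.fst_add_snd x]
  exact add_mem (apply_mem_traceIn_of_generates hA (LinearMap.inl Λ A B) x.1)
    (apply_mem_traceIn_of_generates hB (LinearMap.inr Λ A B) x.2)

theorem mem_traceIn_subtype {K : Submodule Λ A} (h : traceIn Λ U A ≤ K) {x : A}
    (hx : x ∈ traceIn Λ U A) : ⟨x, h hx⟩ ∈ traceIn Λ U K := by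
  have key : traceIn Λ U A ≤ (traceIn Λ U K).map K.subtype := traceIn_le.mpr fun f y ↦
    ⟨f.codRestrict K (fun z ↦ h (apply_mem_traceIn f z)) y, apply_mem_traceIn _ _, rfl⟩
  obtain ⟨y, hy, rfl⟩ := key hx
  exact hy

theorem generates_traceIn : traceIn Λ U (traceIn Λ U A) = ⊤ :=
  top_le_iff.mp fun x _ ↦ mem_traceIn_subtype le_rfl x.2

/-- The map induced on traces. -/
def traceMap (U : Type*) [AddCommGroup U] [Module Λ U] (φ : A →ₗ[Λ] A') :
    traceIn Λ U A →ₗ[Λ] traceIn Λ U A' :=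
  φ.restrict (traceIn_le_comap φ)

theorem IsInAdd.traceIn (h : IsInAdd Λ A B) : IsInAdd Λ (traceIn Λ U A) (traceIn Λ U B) := by
  obtain ⟨κ, _, f, g, hfg⟩ := h
  refine ⟨κ, inferInstance, fun i ↦ traceMap U (f i), fun i ↦ traceMap U (g i), ?_⟩
  ext x
  have := LinearMap.congr_fun hfg x
  simpa [traceMap] using this

theorem isInAdd_traceIn_prod (hA : IsInAdd Λ (traceIn Λ U A) C)
    (hB : IsInAdd Λ (traceIn Λ U B) C) : IsInAdd Λ (traceIn Λ U (A × B)) C := by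
  have h := ((hA.comp_left (traceMap U (LinearMap.inl Λ A B))).comp_right
    (traceMap U (LinearMap.fst Λ A B))).add
    ((hB.comp_left (traceMap U (LinearMap.inr Λ A B))).comp_right
    (traceMap U (LinearMap.snd Λ A B)))
  rw [IsInAdd]
  convert h using 1
  ext x <;> simp [traceMap]

theorem isInAdd_traceIn_of_generates (h : traceIn Λ U A = ⊤) : IsInAdd Λ (traceIn Λ U A) A :=
  .of_equiv ((LinearEquiv.ofEq _ _ h).trans Submodule.topEquiv)

/-- If B generates U, every map from U to A lands in the trace of B, so computing the trace of U
inside that smaller module loses nothing. -/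
theorem isInAdd_traceIn_traceIn (h : traceIn Λ B U = ⊤) :
    IsInAdd Λ (traceIn Λ U A) (traceIn Λ U (traceIn Λ B A)) :=
  .of_retract
    (((traceIn Λ U A).subtype.codRestrict (traceIn Λ B A)
      fun x ↦ traceIn_le_of_generates h x.2).codRestrict _
        fun x ↦ mem_traceIn_subtype (traceIn_le_of_generates h) x.2)
    (traceMap U (traceIn Λ B A).subtype) rfl

end Trace

/-! ### The radical part of a module over its endomorphism ring -/

section Radical

variable {Λ : Type u} [Ring Λ]
variable {A B L M : Type v} [AddCommGroup A] [Module Λ A] [AddCommGroup B] [Module Λ B]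
  [AddCommGroup L] [Module Λ L] [AddCommGroup M] [Module Λ M]

/-- The ring of endomorphisms acting from the right. -/
abbrev EndOp (Λ : Type u) [Ring Λ] (A : Type v) [AddCommGroup A] [Module Λ A] : Type v :=
  (Module.End Λ A)ᵐᵒᵖ

/-- The radicals of endomorphism rings form an ideal of the module category: composing a radical
endomorphism of A with maps from and to B gives a radical endomorphism of B. -/
theorem op_comp_mem_jacobson {j : EndOp Λ A} (hj : j ∈ Ring.jacobson (EndOp Λ A)) (p : B →ₗ[Λ] A)
    (q : A →ₗ[Λ] B) :
    (MulOpposite.op (q ∘ₗ j.unop ∘ₗ p) : EndOp Λ B) ∈ Ring.jacobson (EndOp Λ B) := by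
  rw [← Ideal.jacobson_bot, Ideal.mem_jacobson_iff]
  intro y
  have hj' : j * MulOpposite.op (p ∘ₗ y.unop ∘ₗ q) ∈ Ideal.jacobson (⊥ : Ideal (EndOp Λ A)) := by
    rw [Ideal.jacobson_bot]
    exact Ideal.mul_mem_right _ _ hj
  obtain ⟨w, hw⟩ := Ideal.mem_jacobson_iff.mp hj' 1
  rw [Submodule.mem_bot, sub_eq_zero] at hw
  have hw' (x : A) : p (y.unop (q (j.unop (w.unop x)))) + w.unop x = x :=
    LinearMap.congr_fun (congrArg MulOpposite.unop hw) x
  -- The one-sided form of (1 + ba)⁻¹ = 1 - b(1 + ab)⁻¹a, with w in the role of (1 + ab)⁻¹.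
  refine ⟨1 - MulOpposite.op (q ∘ₗ j.unop ∘ₗ w.unop ∘ₗ p ∘ₗ y.unop), ?_⟩
  rw [Submodule.mem_bot, sub_eq_zero]
  apply MulOpposite.unop_injective
  ext x
  have h := congrArg (fun z ↦ q (j.unop z)) (hw' (p (y.unop x)))
  simp only [map_add] at h
  simp only [MulOpposite.unop_add, MulOpposite.unop_mul, MulOpposite.unop_sub,
    MulOpposite.unop_one, MulOpposite.unop_op, LinearMap.add_apply, Module.End.mul_apply,
    LinearMap.sub_apply, LinearMap.comp_apply, Module.End.one_apply, map_sub]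
  rw [← h]
  abel_nf

/-- The sum of the images of the endomorphisms in the Jacobson radical. -/
def radIn (Λ : Type u) [Ring Λ] (M : Type v) [AddCommGroup M] [Module Λ M] : Submodule Λ M :=
  ⨆ j : Ring.jacobson (EndOp Λ M), LinearMap.range j.1.unop

theorem apply_mem_radIn {j : EndOp Λ M} (hj : j ∈ Ring.jacobson (EndOp Λ M)) (x : M) :
    j.unop x ∈ radIn Λ M :=
  Submodule.mem_iSup_of_mem ⟨j, hj⟩ ⟨x, rfl⟩

theorem radIn_le {K : Submodule Λ M} :
    radIn Λ M ≤ K ↔ ∀ j ∈ Ring.jacobson (EndOp Λ M), ∀ x, j.unop x ∈ K := by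
  refine iSup_le_iff.trans ⟨fun h j hj x ↦ h ⟨j, hj⟩ ⟨x, rfl⟩, ?_⟩
  rintro h ⟨j, hj⟩ _ ⟨x, rfl⟩
  exact h j hj x

theorem generates_radIn : traceIn Λ M (radIn Λ M) = ⊤ := by
  have h : radIn Λ M ≤ (traceIn Λ M (radIn Λ M)).map (radIn Λ M).subtype :=
    radIn_le.mpr fun j hj x ↦ ⟨j.unop.codRestrict _ (fun y ↦ apply_mem_radIn hj y) x,
      apply_mem_traceIn _ _, rfl⟩
  refine top_le_iff.mp fun x _ ↦ ?_
  obtain ⟨y, hy, hyx⟩ := h x.2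
  rwa [← Subtype.ext hyx]

/-- Nakayama by nilpotency: if MJ = M then MJ^k = M for all k, while some J^k is zero. This makes
the induction on length terminate. -/
theorem radIn_ne_top [IsArtinianRing (EndOp Λ M)] [Nontrivial M] : radIn Λ M ≠ ⊤ := by
  intro htop
  have key (k : ℕ) : (⨆ j : (Ring.jacobson (EndOp Λ M) ^ k : Ideal (EndOp Λ M)),
      LinearMap.range j.1.unop) = ⊤ := by
    induction k with
    | zero =>
      refine top_le_iff.mp fun x _ ↦ Submodule.mem_iSup_of_mem ⟨1, ?_⟩ ⟨x, rfl⟩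
      rw [Submodule.pow_zero, Ideal.one_eq_top]
      trivial
    | succ k ih =>
      rw [eq_top_iff, ← htop, radIn_le]
      intro j hj x
      have hx : x ∈ ⨆ j : (Ring.jacobson (EndOp Λ M) ^ k : Ideal (EndOp Λ M)),
        LinearMap.range j.1.unop := ih ▸ Submodule.mem_top
      refine Submodule.iSup_induction _ (motive := fun x ↦ j.unop x ∈ _) hx ?_ ?_ ?_
      · rintro ⟨a, ha⟩ _ ⟨z, rfl⟩
        refine Submodule.mem_iSup_of_mem ⟨a * j, ?_⟩ ⟨z, rfl⟩
        rw [Submodule.pow_succ]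
        exact Ideal.mul_mem_mul ha hj
      · rw [map_zero]; exact zero_mem _
      · intro y z hy hz
        rw [map_add]; exact add_mem hy hz
  obtain ⟨k, hk⟩ := (IsSemiprimaryRing.isNilpotent : IsNilpotent (Ring.jacobson (EndOp Λ M)))
  have h := key k
  rw [hk] at h
  refine bot_ne_top (α := Submodule Λ M) (h ▸ (iSup_eq_bot.mpr ?_).symm)
  rintro ⟨j, hj⟩
  obtain rfl : j = 0 := hj
  exact LinearMap.range_zero

/-- The trace of the radical part of `M` in `M` is a summand of copies of the radical part. -/
theorem isInAdd_traceIn_radIn [IsArtinianRing (EndOp Λ M)] :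
    IsInAdd Λ (traceIn Λ (radIn Λ M) M) (radIn Λ M) := by
  let J := Ring.jacobson (EndOp Λ M)
  let a : Ideal (EndOp Λ M) :=
    { carrier := {x | FactorsThroughAdd (radIn Λ M) x.unop}
      add_mem' := fun hx hy ↦ hx.add hy
      zero_mem' := .zero
      smul_mem' := fun c x hx ↦ hx.comp_right c.unop }
  -- Modulo J, the maps factoring through add of the radical part form a left ideal of a semisimple
  -- ring, generated by an idempotent. Any lift e in the ideal `a` will do; e itself need not be
  -- idempotent.
  obtain ⟨ebar, hidem, he⟩ :=
    IsSemisimpleRing.ideal_eq_span_idempotent (a.map (Ideal.Quotient.mk J))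
  have hebar : ebar ∈ a.map (Ideal.Quotient.mk J) := he ▸ Ideal.mem_span_singleton_self ebar
  obtain ⟨e, hea, rfl⟩ :=
    (Ideal.mem_map_iff_of_surjective _ Ideal.Quotient.mk_surjective).mp hebar
  have hmul (b : EndOp Λ M) (hb : b ∈ a) : b - b * e ∈ J := by
    have hb' := Ideal.mem_map_of_mem (Ideal.Quotient.mk J) hb
    rw [he] at hb'
    obtain ⟨c, hc⟩ := Ideal.mem_span_singleton'.mp hb'
    rw [← Ideal.Quotient.eq_zero_iff_mem, map_sub, map_mul, ← hc, mul_assoc, hidem.eq, sub_self]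
  have hle : radIn Λ M ≤ traceIn Λ (radIn Λ M) M := fun x hx ↦
    apply_mem_traceIn (radIn Λ M).subtype ⟨x, hx⟩
  -- For g from MJ to M and j in J, the composite of j and g lies in `a`, so following it by 1 - e
  -- gives an element of J, with image in MJ. The images of such j span MJ, hence 1 - e sends the
  -- whole trace into MJ.
  have hrad : traceIn Λ (radIn Λ M) M ≤ (radIn Λ M).comap (LinearMap.id - e.unop) := by
    refine traceIn_le.mpr fun g ↦ ?_
    rintro ⟨y, hy⟩
    have h : radIn Λ M ≤ (((radIn Λ M).comap ((LinearMap.id - e.unop) ∘ₗ g)).map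
        (radIn Λ M).subtype) := by
      refine radIn_le.mpr fun j hj z ↦ ⟨⟨j.unop z, apply_mem_radIn hj z⟩, ?_, rfl⟩
      exact apply_mem_radIn (hmul (MulOpposite.op (g ∘ₗ j.unop.codRestrict (radIn Λ M)
        fun z ↦ apply_mem_radIn hj z)) (FactorsThroughAdd.of_comp _ _)) z
    obtain ⟨y', hy', hyy⟩ := h hy
    obtain rfl : y' = ⟨y, hy⟩ := Subtype.ext hyy
    exact hy'
  have h₁ : FactorsThroughAdd (radIn Λ M) (traceMap (radIn Λ M) e.unop) := by
    obtain ⟨κ, _, f, g, hfg⟩ := (hea : FactorsThroughAdd (radIn Λ M) e.unop)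
    refine ⟨κ, inferInstance, fun i ↦ f i ∘ₗ (traceIn Λ (radIn Λ M) M).subtype,
      fun i ↦ (g i).codRestrict _ (apply_mem_traceIn (g i)), ?_⟩
    ext x
    have := LinearMap.congr_fun hfg x
    simpa [traceMap] using this
  -- On the trace, the identity is e + (1 - e): the first term factors through add of MJ, the second
  -- through MJ itself.
  have h₂ := h₁.add (.of_comp (((LinearMap.id - e.unop).domRestrict _).codRestrict (radIn Λ M)
    fun x ↦ hrad x.2) (Submodule.inclusion hle))
  rw [IsInAdd]
  convert h₂ using 1
  ext x
  exact (add_sub_cancel (e.unop x.1) x.1).symm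

end Radical

/-! ### Radical filtrations and the ideals they define -/

section Filtration

variable {Λ : Type u} [Ring Λ]
variable {L M N Z : Type v} [AddCommGroup L] [Module Λ L] [AddCommGroup M] [Module Λ M]
  [AddCommGroup N] [Module Λ N] [AddCommGroup Z] [Module Λ Z]

/-- A sequence of modules `U 0, U 1, …, U m = 0` in `add L`, each generated by its predecessor and
containing in its trace the radical part of its predecessor, such that the trace of `U n` in `L`
belongs to `add (U n)`. -/
structure IsRadicalFiltration (L : Type v) [AddCommGroup L] [Module Λ L]
    (U : ℕ → ModuleCat.{v} Λ) (m : ℕ) : Prop where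
  mem_add : ∀ n, IsInAdd Λ (U n) L
  trace_mem_add : ∀ n, IsInAdd Λ (traceIn Λ (U n) L) (U n)
  generates : ∀ n, traceIn Λ (U n) (U (n + 1)) = ⊤
  radIn_le : ∀ n, radIn Λ (U n) ≤ traceIn Λ (U (n + 1)) (U n)
  zero : traceIn Λ (U 0) L = ⊤
  last : Subsingleton (U m)

/-- Enlarging L inside add L leaves the filtration valid, since traces respect finite sums and
summands. This permits adding a complement to an injective hull later. -/
theorem IsRadicalFiltration.prod {U : ℕ → ModuleCat.{v} Λ} {m : ℕ}
    (h : IsRadicalFiltration L U m) (hZ : IsInAdd Λ Z L) : IsRadicalFiltration (L × Z) U m where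
  mem_add n := (h.mem_add n).trans
    (.of_retract (LinearMap.inl Λ L Z) (LinearMap.fst Λ L Z) (by ext; simp))
  trace_mem_add n :=
    isInAdd_traceIn_prod (h.trace_mem_add n) (hZ.traceIn.trans (h.trace_mem_add n))
  generates := h.generates
  radIn_le := h.radIn_le
  zero := generates_prod h.zero (generates_trans h.zero hZ.generates)
  last := h.last

/-- The ideal of endomorphisms with image in the trace of `U`. -/
def traceIdeal (U : Type*) [AddCommGroup U] [Module Λ U] (L : Type v) [AddCommGroup L]
    [Module Λ L] : Ideal (EndOp Λ L) where
  carrier := {f | ∀ x, f.unop x ∈ traceIn Λ U L}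
  add_mem' hf hg x := add_mem (hf x) (hg x)
  zero_mem' _ := zero_mem _
  smul_mem' c _ hf x := hf (c.unop x)

section

variable {U : Type*} [AddCommGroup U] [Module Λ U]

instance : (traceIdeal U L : Ideal (EndOp Λ L)).IsTwoSided :=
  ⟨fun {_} c hf x ↦ traceIn_le_comap c.unop (hf x)⟩

/-- As a left module the ideal is Hom(L, T) with T the trace of U; for T in add L this is a summand
of a free module. -/
theorem projective_traceIdeal (h : IsInAdd Λ (traceIn Λ U L) L) :
    Module.Projective (EndOp Λ L) (traceIdeal U L : Ideal (EndOp Λ L)) := by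
  obtain ⟨κ, _, f, g, hfg⟩ := h
  let s : (traceIdeal U L : Ideal (EndOp Λ L)) →ₗ[EndOp Λ L] (κ → EndOp Λ L) :=
    { toFun := fun x i ↦ MulOpposite.op (f i ∘ₗ x.1.unop.codRestrict _ x.2)
      map_add' := fun x y ↦ by
        ext i : 1
        apply MulOpposite.unop_injective
        ext z
        exact map_add (f i) ⟨x.1.unop z, x.2 z⟩ ⟨y.1.unop z, y.2 z⟩
      map_smul' := fun c x ↦ rfl }
  let r : (κ → EndOp Λ L) →ₗ[EndOp Λ L] (traceIdeal U L : Ideal (EndOp Λ L)) :=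
    ∑ i, (LinearMap.toSpanSingleton (EndOp Λ L) (traceIdeal U L : Ideal (EndOp Λ L))
      ⟨MulOpposite.op ((traceIn Λ U L).subtype ∘ₗ g i), fun x ↦ (g i x).2⟩) ∘ₗ LinearMap.proj i
  refine Module.Projective.of_split s r ?_
  ext x : 1
  apply Subtype.ext
  apply MulOpposite.unop_injective
  ext z
  have := congrArg Subtype.val (LinearMap.congr_fun hfg ⟨x.1.unop z, x.2 z⟩)
  simpa [r, s] using! this

theorem traceIdeal_mul_self (h : IsInAdd Λ (traceIn Λ U L) L) :
    (traceIdeal U L * traceIdeal U L : Ideal (EndOp Λ L)) = traceIdeal U L := by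
  refine le_antisymm Ideal.mul_le_left fun x hx ↦ ?_
  obtain ⟨κ, _, f, g, hfg⟩ := h
  have hx' : x = ∑ i, (MulOpposite.op (f i ∘ₗ x.unop.codRestrict (traceIn Λ U L) hx) : EndOp Λ L) *
      MulOpposite.op ((traceIn Λ U L).subtype ∘ₗ g i) := by
    apply MulOpposite.unop_injective
    ext z
    have := congrArg Subtype.val (LinearMap.congr_fun hfg ⟨x.unop z, hx z⟩)
    simpa using! this.symm
  rw [hx']
  exact sum_mem fun i _ ↦ Ideal.mul_mem_mul
    (fun z ↦ apply_mem_traceIn_of_generates generates_traceIn (f i) _) fun z ↦ (g i z).2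

end

/-- In a product f, j, g read left to right, f takes values in sums of images of maps p from U, and
g ends in the trace, hence factors through copies of U. Between these copies of U lie radical
endomorphisms, whose images fall in the trace of V. -/
theorem traceIdeal_mul_jacobson_mul {U V : Type v} [AddCommGroup U] [Module Λ U] [AddCommGroup V]
    [Module Λ V] (h : IsInAdd Λ (traceIn Λ U L) U) (hrad : radIn Λ U ≤ traceIn Λ V U) :
    (traceIdeal U L * Ring.jacobson (EndOp Λ L) * traceIdeal U L : Ideal (EndOp Λ L)) ≤
      traceIdeal V L := by
  refine Ideal.mul_le.mpr fun y hy g hg ↦ ?_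
  have key : traceIn Λ U L ≤
      (⨅ j : Ring.jacobson (EndOp Λ L), (traceIn Λ V L).comap (g.unop ∘ₗ j.1.unop)) := by
    refine traceIn_le.mpr fun p x ↦ (Submodule.mem_iInf _).mpr fun ⟨j, hj⟩ ↦ ?_
    obtain ⟨κ, _, q, r, hqr⟩ := h
    let g' : L →ₗ[Λ] traceIn Λ U L := g.unop.codRestrict _ hg
    have hx : g.unop (j.unop (p x)) =
        ∑ i, ((traceIn Λ U L).subtype ∘ₗ r i) ((q i ∘ₗ g') (j.unop (p x))) := by
      have := congrArg Subtype.val (LinearMap.congr_fun hqr (g' (j.unop (p x))))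
      simpa [g'] using! this.symm
    rw [Submodule.mem_comap, LinearMap.comp_apply, hx]
    exact sum_mem fun i _ ↦ traceIn_le_comap _
      (hrad (apply_mem_radIn (op_comp_mem_jacobson hj p (q i ∘ₗ g')) x))
  refine Submodule.smul_induction_on (p := fun y ↦ y * g ∈ traceIdeal V L) hy ?_ ?_
  · intro f hf j hj x
    exact (Submodule.mem_iInf _).mp (key (hf x)) ⟨j, hj⟩
  · intro a b ha hb
    rw [add_mul]
    exact add_mem ha hb

theorem IsRadicalFiltration.isProjectiveHeredityChain {U : ℕ → ModuleCat.{v} Λ} {m : ℕ}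
    (h : IsRadicalFiltration L U m) :
    IsProjectiveHeredityChain (fun n ↦ (traceIdeal (U n) L : Ideal (EndOp Λ L))) m where
  isTwoSided n := inferInstance
  zero := top_le_iff.mp fun f _ x ↦ h.zero ▸ Submodule.mem_top
  last := by
    have := h.last
    refine eq_bot_iff.mpr fun f hf ↦ MulOpposite.unop_injective (LinearMap.ext fun x ↦ ?_)
    have h0 : traceIn Λ (U m) L ≤ ⊥ := traceIn_le.mpr fun g y ↦ by
      rw [Subsingleton.elim y 0, map_zero]; exact zero_mem _
    exact h0 (hf x)
  succ_le n f hf x := traceIn_le_of_generates (h.generates n) (hf x)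
  mul_self n := traceIdeal_mul_self ((h.trace_mem_add n).trans (h.mem_add n))
  projective n := projective_traceIdeal ((h.trace_mem_add n).trans (h.mem_add n))
  mul_jacobson_mul n := traceIdeal_mul_jacobson_mul (h.trace_mem_add n) (h.radIn_le n)

/-- The inductive step for constructing radical filtrations. -/
theorem IsRadicalFiltration.step [IsArtinianRing (EndOp Λ M)] {U : ℕ → ModuleCat.{v} Λ} {m : ℕ}
    (h : IsRadicalFiltration (radIn Λ M × N) U m) (hN : traceIn Λ (radIn Λ M) N = ⊤) :
    IsRadicalFiltration (M × (radIn Λ M × N))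
      (fun n ↦ Nat.casesOn n (ModuleCat.of Λ (M × (radIn Λ M × N))) U) (m + 1) := by
  have hadd : IsInAdd Λ (radIn Λ M × N) (M × (radIn Λ M × N)) :=
    .of_retract (LinearMap.inr Λ _ _) (LinearMap.snd Λ _ _) (by ext <;> simp)
  have hR : IsInAdd Λ (radIn Λ M) (radIn Λ M × N) :=
    .of_retract (LinearMap.inl Λ _ _) (LinearMap.fst Λ _ _) (by ext; simp)
  have hgen (n : ℕ) : traceIn Λ (radIn Λ M) (U n) = ⊤ :=
    generates_trans (generates_prod generates_self hN) (h.mem_add n).generates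
  refine ⟨?_, ?_, ?_, ?_, generates_self, h.last⟩
  · rintro (_ | n)
    · exact .refl
    · exact (h.mem_add n).trans hadd
  · rintro (_ | n)
    · exact isInAdd_traceIn_of_generates generates_self
    -- `U n` is generated by the radical part R of M, so its trace in M is computed inside the trace
    -- of R in M, which lies in add R.
    · refine isInAdd_traceIn_prod ?_ (h.trace_mem_add n)
      exact (isInAdd_traceIn_traceIn (hgen n)).trans
        ((isInAdd_traceIn_radIn.trans hR).traceIn.trans (h.trace_mem_add n))
  · rintro (_ | n)
    · exact ((h.mem_add 0).trans hadd).generates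
    · exact h.generates n
  · rintro (_ | n)
    · have hsnd (z : radIn Λ M × N) : LinearMap.inr Λ M (radIn Λ M × N) z ∈
          traceIn Λ (U 0) (M × (radIn Λ M × N)) := apply_mem_traceIn_of_generates h.zero _ _
      have hfst (z : radIn Λ M) : LinearMap.inl Λ M (radIn Λ M × N) z ∈
          traceIn Λ (U 0) (M × (radIn Λ M × N)) :=
        apply_mem_traceIn_of_generates (generates_trans h.zero hR.generates)
          (LinearMap.inl Λ M (radIn Λ M × N) ∘ₗ (radIn Λ M).subtype) z
      -- `U 0` generates everything coming from or lying in R × N. Only the M-to-M entry of j is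
      -- left; it is a radical endomorphism of M, so its image lies in R.
      refine _root_.radIn_le.mpr fun j hj x ↦ ?_
      change j.unop x ∈ traceIn Λ (U 0) (M × (radIn Λ M × N))
      rw [← Prod.fst_add_snd x, map_add]
      refine add_mem ?_ (traceIn_le_comap j.unop (hsnd x.2))
      rw [← Prod.fst_add_snd (j.unop (x.1, 0))]
      refine add_mem (hfst ⟨_, ?_⟩) (hsnd _)
      exact apply_mem_radIn (op_comp_mem_jacobson hj (LinearMap.inl Λ M (radIn Λ M × N))
        (LinearMap.fst Λ M (radIn Λ M × N))) x.1
    · exact h.radIn_le n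

/-- Induction on the length of M, passing to its radical part. That M generates N is carried along
because the inductive step needs it. -/
theorem exists_isRadicalFiltration [IsArtinianRing Λ]
    (hE : ∀ (X : Type v) [AddCommGroup X] [Module Λ X] [Module.Finite Λ X],
      IsArtinianRing (EndOp Λ X))
    (M : Type v) [AddCommGroup M] [Module Λ M] [Module.Finite Λ M] :
    ∃ (N : Type v) (_ : AddCommGroup N) (_ : Module Λ N), Module.Finite Λ N ∧
      traceIn Λ M N = ⊤ ∧
        ∃ (U : ℕ → ModuleCat.{v} Λ) (m : ℕ), IsRadicalFiltration (M × N) U m := by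
  induction hl : Module.length Λ M using WellFoundedLT.induction generalizing M with
  | ind l ih =>
    subst hl
    rcases subsingleton_or_nontrivial M with hM | hM
    · refine ⟨M, inferInstance, inferInstance, inferInstance, generates_self,
        fun _ ↦ ModuleCat.of Λ (M × M), 0, ?_⟩
      exact ⟨fun _ ↦ .refl, fun _ ↦ isInAdd_traceIn_of_generates generates_self,
        fun _ ↦ generates_self, fun _ ↦ le_top.trans generates_self.ge, generates_self,
        inferInstanceAs (Subsingleton (M × M))⟩
    · have := hE M
      obtain ⟨N, _, _, _, hN, U, m, h⟩ :=
        ih _ (Submodule.length_lt radIn_ne_top) (radIn Λ M) rfl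
      exact ⟨radIn Λ M × N, inferInstance, inferInstance, inferInstance,
        generates_prod generates_radIn (generates_trans generates_radIn hN), _, _, h.step hN⟩

end Filtration

/-! ### Endomorphism rings of finitely generated modules are artin algebras -/

section ArtinAlgebra

theorem IsArtinAlgebra.isArtinianRing {Λ : Type u} [Ring Λ] (hΛ : IsArtinAlgebra Λ) :
    IsArtinianRing Λ := by
  obtain ⟨R, _, _, _, _⟩ := hΛ
  exact isArtinian_of_tower R inferInstance

theorem finite_linearMap_of_isNoetherianRing {R Λ A B : Type*} [CommRing R] [IsNoetherianRing R]
    [Ring Λ] [Algebra R Λ] [AddCommGroup A] [Module R A] [Module Λ A] [IsScalarTower R Λ A]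
    [AddCommGroup B] [Module R B] [Module Λ B] [IsScalarTower R Λ B] [SMulCommClass Λ R B]
    [Module.Finite Λ A] [Module.Finite R B] : Module.Finite R (A →ₗ[Λ] B) := by
  obtain ⟨n, g, hg⟩ := Module.Finite.exists_fin (R := Λ) (M := A)
  let φ : (A →ₗ[Λ] B) →ₗ[R] (Fin n → B) :=
    { toFun := fun f i ↦ f (g i), map_add' := fun _ _ ↦ rfl, map_smul' := fun _ _ ↦ rfl }
  refine Module.Finite.of_injective φ fun f f' h ↦ LinearMap.ext_on_range hg fun i ↦ ?_
  exact congrFun h i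

/-- The base ring may live in another universe than Γ; the center of Γ replaces it. -/
theorem IsArtinAlgebra.of_finite {R : Type*} {Γ : Type v} [CommRing R] [IsArtinianRing R]
    [Ring Γ] [Algebra R Γ] [Module.Finite R Γ] : IsArtinAlgebra Γ := by
  let : Algebra (Subalgebra.center R Γ) Γ := (Subalgebra.center R Γ).val.toRingHom.toAlgebra'
    fun c x ↦ (Subalgebra.mem_center_iff.mp c.2 x).symm
  have : @IsScalarTower R (Subalgebra.center R Γ) Γ _ Algebra.toSMul _ := ⟨fun r c x ↦ smul_mul_assoc r c.1 x⟩
  refine ⟨Subalgebra.center R Γ, inferInstance, inferInstance, ?_, ?_⟩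
  · have : IsArtinian R (Subalgebra.toSubmodule (Subalgebra.center R Γ)) := inferInstance
    exact isArtinian_of_tower R this
  · exact Module.Finite.of_restrictScalars_finite R _ _

theorem IsArtinAlgebra.endOp {Λ : Type u} [Ring Λ] (hΛ : IsArtinAlgebra Λ) (L : Type v)
    [AddCommGroup L] [Module Λ L] [Module.Finite Λ L] : IsArtinAlgebra (EndOp Λ L) := by
  obtain ⟨R, _, _, _, _⟩ := hΛ
  let : Module R L := Module.compHom L (algebraMap R Λ)
  have : IsScalarTower R Λ L := IsScalarTower.of_algebraMap_smul fun _ _ ↦ rfl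
  have : Module.Finite R L := Module.Finite.trans Λ L
  have : SMulCommClass Λ R L := inferInstance
  have : Module.Finite R (Module.End Λ L) := finite_linearMap_of_isNoetherianRing
  have : Module.Finite R (EndOp Λ L) := Module.Finite.equiv (MulOpposite.opLinearEquiv R)
  exact .of_finite (R := R)

theorem exists_isQuasiHereditary_endOp {Λ : Type u} [Ring Λ] (hΛ : IsArtinAlgebra Λ) (M : Type v)
    [AddCommGroup M] [Module Λ M] [Module.Finite Λ M] :
    ∃ (N : Type v) (_ : AddCommGroup N) (_ : Module Λ N), Module.Finite Λ N ∧
        IsQuasiHereditary (EndOp Λ (M × N)) := by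
  have := hΛ.isArtinianRing
  obtain ⟨N, _, _, _, _, U, m, h⟩ := exists_isRadicalFiltration
    (fun X _ _ _ ↦ (hΛ.endOp X).isArtinianRing) M
  have hL := hΛ.endOp (M × N)
  have := hL.isArtinianRing
  exact ⟨N, inferInstance, inferInstance, inferInstance,
    h.isProjectiveHeredityChain.isQuasiHereditary hL⟩

end ArtinAlgebra

/-! ### Injective hulls as direct summands -/

section InjectiveHull

variable {Γ : Type u} [Ring Γ]

theorem exists_maximal_disjoint_submodule {X : Type*} [AddCommGroup X] [Module Γ X]
    {A B : Submodule Γ X} (h : Disjoint A B) :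
    ∃ C, A ≤ C ∧ Maximal (fun C : Submodule Γ X ↦ Disjoint C B) C := by
  refine zorn_le_nonempty₀ {C : Submodule Γ X | Disjoint C B} ?_ A h
  intro c hc hchain C hC
  refine ⟨sSup c, Submodule.disjoint_def.mpr fun x hx hxB ↦ ?_, fun _ ↦ le_sSup⟩
  obtain ⟨D, hD, hxD⟩ := (Submodule.mem_sSup_of_directed ⟨C, hC⟩ hchain.directedOn).mp hx
  exact Submodule.disjoint_def.mp (hc hD) x hxD hxB

theorem injective_of_retract {X Q : Type u} [AddCommGroup X] [Module Γ X] [AddCommGroup Q]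
    [Module Γ Q] [Module.Injective Γ Q] (i : X →ₗ[Γ] Q) (r : Q →ₗ[Γ] X)
    (h : r ∘ₗ i = LinearMap.id) : Module.Injective Γ X := by
  refine ⟨fun A B _ _ _ _ f hf g ↦ ?_⟩
  obtain ⟨k, hk⟩ := Module.Injective.out f hf (i ∘ₗ g)
  refine ⟨r ∘ₗ k, fun x ↦ ?_⟩
  rw [LinearMap.comp_apply, hk]
  exact LinearMap.congr_fun h (g x)

/-- A submodule of an injective module is essential in some direct summand. -/
theorem exists_isCompl_essential {Q : Type u} [AddCommGroup Q] [Module Γ Q] [Module.Injective Γ Q]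
    (X : Submodule Γ Q) :
    ∃ E C : Submodule Γ Q, IsCompl E C ∧ X ≤ E ∧ ∀ V ≤ E, Disjoint X V → V = ⊥ := by
  -- C is maximal disjoint from X, and E ≥ X is maximal disjoint from C. Injectivity then yields a
  -- projection of Q onto E with kernel C.
  obtain ⟨C, -, hC⟩ := exists_maximal_disjoint_submodule (disjoint_bot_left (a := X))
  obtain ⟨E, hXE, hE⟩ := exists_maximal_disjoint_submodule hC.prop.symm
  have hess (W : Submodule Γ Q) (hCW : C ≤ W) (hW : Disjoint W E) : W = C :=
    (hC.eq_of_le (hW.mono_right hXE) hCW).symm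
  refine ⟨E, C, ⟨hE.prop, ?_⟩, hXE, fun V hV hXV ↦ ?_⟩
  · let q : E →ₗ[Γ] Q ⧸ C := C.mkQ.domRestrict E
    have hq : Function.Injective q := by
      refine (injective_iff_map_eq_zero _).mpr fun x hx ↦ Subtype.ext ?_
      exact Submodule.disjoint_def.mp hE.prop x.1 x.2 ((Submodule.Quotient.mk_eq_zero C).mp hx)
    obtain ⟨φ, hφ⟩ := Module.Injective.out q hq E.subtype
    have hφE (x : Q) (hx : x ∈ E) : φ (Submodule.Quotient.mk x) = x := hφ ⟨x, hx⟩
    have hker : LinearMap.ker (φ ∘ₗ C.mkQ) = C := by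
      refine hess _ (fun x hx ↦ ?_) (Submodule.disjoint_def.mpr fun x hx hxE ↦ ?_)
      · rw [LinearMap.mem_ker, LinearMap.comp_apply, Submodule.mkQ_apply,
          (Submodule.Quotient.mk_eq_zero C).mpr hx, map_zero]
      · rw [← hφE x hxE]
        exact hx
    -- Needed so that the image of the map meets C trivially; as it contains E, maximality of E
    -- forces equality.
    have hpre : C.comap (φ ∘ₗ C.mkQ) = C := by
      refine hess _ (fun x hx ↦ ?_) (Submodule.disjoint_def.mpr fun x hx hxE ↦ ?_)
      · have : (φ ∘ₗ C.mkQ) x = 0 := LinearMap.mem_ker.mp (hker.symm ▸ hx)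
        rw [Submodule.mem_comap, this]
        exact zero_mem C
      · refine Submodule.disjoint_def.mp hE.prop x hxE ?_
        rw [← hφE x hxE]
        exact hx
    have hrange : E = LinearMap.range (φ ∘ₗ C.mkQ) := by
      refine hE.eq_of_le (Submodule.disjoint_def.mpr ?_) fun x hx ↦ ⟨x, hφE x hx⟩
      rintro _ ⟨x, rfl⟩ hxC
      have hx : x ∈ C.comap (φ ∘ₗ C.mkQ) := hxC
      rw [hpre, ← hker] at hx
      exact hx
    refine codisjoint_iff_le_sup.mpr fun x _ ↦ ?_
    let e := φ (Submodule.Quotient.mk x)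
    have he : e ∈ E := by rw [hrange]; exact ⟨x, rfl⟩
    have hxe : x - e ∈ C := by
      rw [← hker, LinearMap.mem_ker, map_sub, sub_eq_zero]
      exact (hφE e he).symm
    rw [← add_sub_cancel e x]
    exact add_mem (Submodule.mem_sup_left he) (Submodule.mem_sup_right hxe)
  · have hCV : Disjoint (C ⊔ V) X := by
      refine Submodule.disjoint_def.mpr fun x hx hxX ↦ ?_
      obtain ⟨c, hc, v, hv, rfl⟩ := Submodule.mem_sup.mp hx
      have hcE : c ∈ E := by
        have := sub_mem (hXE hxX) (hV hv)
        rwa [add_sub_cancel_right] at this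
      obtain rfl := Submodule.disjoint_def.mp hE.prop c hcE hc
      rw [zero_add] at hxX ⊢
      exact Submodule.disjoint_def.mp hXV v hxX hv
    have hVC : V ≤ C := le_sup_right.trans (hC.eq_of_le hCV le_sup_left).ge
    exact eq_bot_iff.mpr fun x hx ↦ Submodule.disjoint_def.mp hE.prop x (hV hx) (hVC hx)

theorem exists_essential_summand {X Q : Type u} [AddCommGroup X] [Module Γ X] [AddCommGroup Q]
    [Module Γ Q] [Module.Injective Γ Q] (f : X →ₗ[Γ] Q) (hf : Function.Injective f) :
    ∃ (E C : Submodule Γ Q) (ι : X →ₗ[Γ] E), IsCompl E C ∧ (∀ x, (ι x : Q) = f x) ∧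
      Function.Injective ι ∧ IsEssentialSubmodule (LinearMap.range ι) ∧ Module.Injective Γ E := by
  obtain ⟨E, C, hEC, hXE, hess⟩ := exists_isCompl_essential (LinearMap.range f)
  refine ⟨E, C, f.codRestrict E fun x ↦ hXE ⟨x, rfl⟩, hEC, fun _ ↦ rfl,
    fun x y h ↦ hf (congrArg Subtype.val h), fun V hV ↦ ?_, ?_⟩
  · have := hess (V.map E.subtype) (Submodule.map_subtype_le _ _)
      (Submodule.disjoint_def.mpr ?_)
    · exact Submodule.map_injective_of_injective E.injective_subtype
        (this.trans (Submodule.map_bot _).symm)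
    · rintro _ ⟨x, rfl⟩ ⟨y, hy, hyx⟩
      have : y ∈ LinearMap.range (f.codRestrict E fun x ↦ hXE ⟨x, rfl⟩) ⊓ V :=
        ⟨⟨x, Subtype.ext hyx.symm⟩, hy⟩
      rw [hV, Submodule.mem_bot] at this
      rw [← hyx, this, map_zero]
  · exact injective_of_retract E.subtype (E.projectionOnto C hEC) (by ext; simp)

theorem exists_injective_embedding (X : Type u) [AddCommGroup X] [Module Γ X] :
    ∃ (Q : Type u) (_ : AddCommGroup Q) (_ : Module Γ Q) (f : X →ₗ[Γ] Q),
      Module.Injective Γ Q ∧ Function.Injective f := by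
  obtain ⟨P⟩ := EnoughInjectives.presentation (ModuleCat.of Γ X)
  have : Injective (ModuleCat.of Γ P.J) := P.injective
  exact ⟨P.J, inferInstance, inferInstance, P.f.hom, Module.injective_module_of_injective_object Γ _,
    (ModuleCat.mono_iff_injective _).mp P.mono⟩

/-- Every module has an injective hull. -/
theorem exists_injective_hull (X : Type u) [AddCommGroup X] [Module Γ X] :
    ∃ (Q : Type u) (_ : AddCommGroup Q) (_ : Module Γ Q) (ι : X →ₗ[Γ] Q),
      Module.Injective Γ Q ∧ Function.Injective ι ∧ IsEssentialSubmodule (LinearMap.range ι) := by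
  obtain ⟨Q, _, _, f, _, hf⟩ := exists_injective_embedding (Γ := Γ) X
  obtain ⟨E, C, ι, -, -, hι, hess, hE⟩ := exists_essential_summand f hf
  exact ⟨E, inferInstance, inferInstance, ι, hE, hι, hess⟩

end InjectiveHull

/-! ### Duality over a commutative artinian ring -/

section MatlisDuality

variable {R : Type u} [CommRing R]

/-- The properties of a dualizing module of a commutative artinian ring. -/
structure IsDualizing (R : Type u) [CommRing R] (E : Type u) [AddCommGroup E] [Module R E] :
    Prop where
  injective : Module.Injective R E
  exists_apply_ne_zero : ∀ (X : Type u) [AddCommGroup X] [Module R X] (x : X), x ≠ 0 →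
    ∃ f : X →ₗ[R] E, f x ≠ 0
  length_le : ∀ (S : Type u) [AddCommGroup S] [Module R S] [IsSimpleModule R S],
    Module.length R (S →ₗ[R] E) ≤ 1

variable {E : Type u} [AddCommGroup E] [Module R E]

theorem IsDualizing.length_dual_le (hE : IsDualizing R E) {X : Type u} [AddCommGroup X] [Module R X]
    (hX : IsFiniteLength R X) : Module.length R (X →ₗ[R] E) ≤ Module.length R X := by
  induction hX with
  | of_subsingleton => rw [Module.length_eq_zero]; exact bot_le
  | @of_simple_quotient M _ _ N _ hN ih =>
    have := hE.injective
    rw [Module.length_eq_add_of_exact N.subtype N.mkQ N.injective_subtype N.mkQ_surjective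
      (LinearMap.exact_subtype_mkQ N), Module.length_eq_one R (M ⧸ N),
      Module.length_eq_add_of_exact (LinearMap.lcomp R E N.mkQ) (LinearMap.lcomp R E N.subtype)
        (fun f g h ↦ by ext x; exact LinearMap.congr_fun h x)
        (fun f ↦ ?_) (fun f ↦ ⟨fun h ↦ ?_, ?_⟩), add_comm]
    · exact add_le_add ih (hE.length_le _)
    · obtain ⟨g, hg⟩ := Module.Injective.out N.subtype N.injective_subtype f
      exact ⟨g, LinearMap.ext hg⟩
    · exact ⟨N.liftQ f fun x hx ↦ LinearMap.congr_fun h ⟨x, hx⟩, rfl⟩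
    · rintro ⟨g, rfl⟩
      ext x
      change g (N.mkQ x) = 0
      rw [Submodule.mkQ_apply, (Submodule.Quotient.mk_eq_zero N).mpr x.2, map_zero]

theorem IsDualizing.isFiniteLength_dual (hE : IsDualizing R E) {X : Type u} [AddCommGroup X]
    [Module R X] (hX : IsFiniteLength R X) : IsFiniteLength R (X →ₗ[R] E) :=
  Module.length_ne_top_iff.mp
    (ne_top_of_le_ne_top (Module.length_ne_top_iff.mpr hX) (hE.length_dual_le hX))

/-- Evaluation into the double dual is injective because functionals separate points, and dualizing
does not increase length, so it is also onto. -/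
theorem IsDualizing.exists_apply_eq (hE : IsDualizing R E) {X : Type u} [AddCommGroup X]
    [Module R X] (hX : IsFiniteLength R X) (φ : (X →ₗ[R] E) →ₗ[R] E) : ∃ x, ∀ f, φ f = f x := by
  let ev : X →ₗ[R] (X →ₗ[R] E) →ₗ[R] E := LinearMap.applyₗ
  have hev : Function.Injective ev := by
    refine (injective_iff_map_eq_zero _).mpr fun x hx ↦ ?_
    by_contra h0
    obtain ⟨f, hf⟩ := hE.exists_apply_ne_zero X x h0
    exact hf (LinearMap.congr_fun hx f)
  have hD := hE.isFiniteLength_dual hX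
  have hDD := isFiniteLength_iff_isNoetherian_isArtinian.mp (hE.isFiniteLength_dual hD)
  obtain ⟨_, _⟩ := hDD
  have hrange : LinearMap.range ev = ⊤ := by
    by_contra h
    have h1 := Submodule.length_lt h
    rw [← (LinearEquiv.ofInjective ev hev).length_eq] at h1
    exact absurd ((hE.length_dual_le hD).trans (hE.length_dual_le hX)) h1.not_ge
  obtain ⟨x, hx⟩ : φ ∈ LinearMap.range ev := hrange ▸ Submodule.mem_top
  exact ⟨x, fun f ↦ (LinearMap.congr_fun hx f).symm⟩

variable [IsArtinianRing R]

instance isSemisimpleModule_quotient_jacobson :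
    IsSemisimpleModule R (R ⧸ Ring.jacobson R) := by
  refine isSemisimpleModule_of_jacobson_smul_eq_zero fun a ha x ↦ ?_
  obtain ⟨x, rfl⟩ := Ideal.Quotient.mk_surjective x
  change Ideal.Quotient.mk _ (a * x) = 0
  exact Ideal.Quotient.eq_zero_iff_mem.mpr (Ideal.mul_mem_right _ _ ha)

/-- R/J is multiplicity free: an element of m whose class is killed by m squares to zero in the
reduced ring R/J. So a nonzero class killed by m is represented by a unit modulo m. -/
theorem exists_smul_eq_of_maximal_smul_eq_zero (m : Ideal R) [hm : m.IsMaximal]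
    (x y : R ⧸ Ring.jacobson R) (hx0 : x ≠ 0) (hx : ∀ a ∈ m, a • x = 0) (hy : ∀ a ∈ m, a • y = 0) :
    ∃ c : R, c • x = y := by
  have key (d : R) (hd : d ∈ m) (h : ∀ a ∈ m, a • (Ideal.Quotient.mk (Ring.jacobson R) d) = 0) :
      Ideal.Quotient.mk (Ring.jacobson R) d = 0 :=
     IsReduced.eq_zero _ ⟨2, by rw [pow_two]; exact h d hd⟩
  obtain ⟨a, rfl⟩ := Ideal.Quotient.mk_surjective x
  obtain ⟨b, rfl⟩ := Ideal.Quotient.mk_surjective y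
  have ha : a ∉ m := fun h ↦ hx0 (key a h hx)
  obtain ⟨c, i, hi, hci⟩ := hm.exists_inv ha
  refine ⟨b * c, ?_⟩
  have h := key (b * c * a - b) ?_ ?_
  · rw [map_sub, sub_eq_zero] at h
    exact h
  · have : b * c * a - b = -(b * i) := by linear_combination b * hci
    rw [this]
    exact neg_mem (Ideal.mul_mem_left _ _ hi)
  · intro z hz
    have : Ideal.Quotient.mk (Ring.jacobson R) (b * c * a - b) =
        (b * c) • Ideal.Quotient.mk (Ring.jacobson R) a - Ideal.Quotient.mk (Ring.jacobson R) b :=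
      map_sub _ _ _
    rw [this, smul_sub, hy z hz, smul_comm, hx z hz, smul_zero, sub_zero]

/-- The injective hull of R/J works: R/J contains every simple module, and by essentiality it
contains the image of every map from a simple module, where multiplicity freeness applies. -/
theorem exists_isDualizing (R : Type u) [CommRing R] [IsArtinianRing R] :
    ∃ (E : Type u) (_ : AddCommGroup E) (_ : Module R E), IsDualizing R E := by
  obtain ⟨E, _, _, ι, hE, hι, hess⟩ := exists_injective_hull (Γ := R) (R ⧸ Ring.jacobson R)
  refine ⟨E, inferInstance, inferInstance, hE, fun X _ _ x hx ↦ ?_, fun S _ _ _ ↦ ?_⟩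
  · let t := LinearMap.toSpanSingleton R X x
    have ht : LinearMap.ker t ≠ ⊤ := fun h ↦ hx (by
      have : (1 : R) ∈ LinearMap.ker t := h ▸ Submodule.mem_top
      simpa [t] using this)
    obtain ⟨m, hm, hle⟩ := Ideal.exists_le_maximal _ ht
    have hJm : Ring.jacobson R ≤ m := Ring.jacobson_le_of_isMaximal m
    -- A section embeds R/m in R/J; the composite Rx → R/m → R/J → E is nonzero at x and extends to
    -- X.
    obtain ⟨h, hh⟩ := IsSemisimpleModule.lifting_property (Submodule.factor hJm)
      (Submodule.factor_surjective hJm) LinearMap.id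
    obtain ⟨f, hf⟩ := Module.Injective.out ((LinearMap.ker t).liftQ t le_rfl)
      (LinearMap.ker_eq_bot.mp (Submodule.ker_liftQ_eq_bot _ _ _ le_rfl))
      ((LinearMap.ker t).liftQ (ι ∘ₗ h ∘ₗ m.mkQ) fun r hr ↦ by
        rw [LinearMap.mem_ker, LinearMap.comp_apply, LinearMap.comp_apply, Submodule.mkQ_apply,
          (Submodule.Quotient.mk_eq_zero m).mpr (hle hr), map_zero, map_zero])
    refine ⟨f, fun h0 ↦ ?_⟩
    have h1 := hf (Submodule.Quotient.mk 1)
    rw [Submodule.liftQ_apply, Submodule.liftQ_apply, LinearMap.toSpanSingleton_apply, one_smul, h0]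
      at h1
    have h2 : h (m.mkQ 1) = 0 := hι (h1.symm.trans (map_zero ι).symm)
    have h3 := LinearMap.congr_fun hh (m.mkQ 1)
    rw [LinearMap.comp_apply, h2, map_zero, LinearMap.id_apply] at h3
    exact hm.ne_top ((Ideal.eq_top_iff_one m).mpr ((Submodule.Quotient.mk_eq_zero m).mp h3.symm))
  · have hrange (f : S →ₗ[R] E) : LinearMap.range f ≤ LinearMap.range ι := by
      rcases f.injective_or_eq_zero with hf | rfl
      · have : IsSimpleModule R (LinearMap.range f) :=
          .congr (LinearEquiv.ofInjective f hf).symm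
        have hatom := isSimpleModule_iff_isAtom.mp this
        by_contra hle
        exact hatom.1 (hess _ (hatom.not_le_iff_disjoint.mp hle).symm.eq_bot)
      · rw [LinearMap.range_zero]; exact bot_le
    rcases subsingleton_or_nontrivial (S →ₗ[R] E) with h | h
    · rw [Module.length_eq_zero]; exact zero_le_one
    refine (Module.length_eq_one_iff.mpr ?_).le
    refine isSimpleModule_iff_toSpanSingleton_surjective.mpr ⟨h, fun f hf g ↦ ?_⟩
    have := IsSimpleModule.nontrivial R S
    obtain ⟨s, hs⟩ := exists_ne (0 : S)
    obtain ⟨x, hx⟩ := hrange f ⟨s, rfl⟩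
    obtain ⟨y, hy⟩ := hrange g ⟨s, rfl⟩
    have := IsSimpleModule.ker_toSpanSingleton_isMaximal R hs
    have hkill (f : S →ₗ[R] E) (x) (hx : ι x = f s) :
        ∀ a ∈ LinearMap.ker (LinearMap.toSpanSingleton R S s), a • x = 0 := fun a ha ↦ hι (by
      rw [map_smul, hx, ← map_smul, map_zero, show a • s = 0 from ha, map_zero])
    have hx0 : x ≠ 0 := fun h0 ↦ hf (LinearMap.ext fun z ↦ by
      obtain ⟨r, rfl⟩ := IsSimpleModule.toSpanSingleton_surjective R hs z
      rw [LinearMap.toSpanSingleton_apply, map_smul, ← hx, h0, map_zero, smul_zero,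
        LinearMap.zero_apply])
    obtain ⟨c, hc⟩ := exists_smul_eq_of_maximal_smul_eq_zero _ x y hx0
      (hkill f x hx) (hkill g y hy)
    refine ⟨c, LinearMap.ext fun z ↦ ?_⟩
    obtain ⟨r, rfl⟩ := IsSimpleModule.toSpanSingleton_surjective R hs z
    simp only [LinearMap.toSpanSingleton_apply, LinearMap.smul_apply, map_smul]
    rw [← hx, ← hy, ← hc, map_smul]

end MatlisDuality

/-! ### The dual of Λ as an injective cogenerator -/

section DualModule

variable (R Λ E : Type u) [CommRing R] [Ring Λ] [Algebra R Λ] [AddCommGroup E] [Module R E]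

/-- The `R`-linear maps from `Λ` to `E`, as a left `Λ`-module. -/
def DualModule : Type u := Λ →ₗ[R] E

namespace DualModule

instance : AddCommGroup (DualModule R Λ E) := inferInstanceAs (AddCommGroup (Λ →ₗ[R] E))

instance : Module R (DualModule R Λ E) := inferInstanceAs (Module R (Λ →ₗ[R] E))

variable {R Λ E}

/-- The linear map underlying an element of the dual module. -/
def toLin (f : DualModule R Λ E) : Λ →ₗ[R] E := f

@[ext]
theorem ext {f g : DualModule R Λ E} (h : ∀ x, f.toLin x = g.toLin x) : f = g :=
  LinearMap.ext h

instance : Module Λ (DualModule R Λ E) where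
  smul a f := f.toLin ∘ₗ LinearMap.mulRight R a
  one_smul f := ext fun x ↦ congrArg f.toLin (mul_one x)
  mul_smul a b f := ext fun x ↦ congrArg f.toLin (mul_assoc x a b).symm
  smul_zero _ := rfl
  smul_add _ _ _ := rfl
  add_smul a b f := ext fun x ↦ (congrArg f.toLin (mul_add x a b)).trans (map_add f.toLin _ _)
  zero_smul f := ext fun x ↦ (congrArg f.toLin (mul_zero x)).trans (map_zero f.toLin)

@[simp] theorem toLin_smul (a : Λ) (f : DualModule R Λ E) (x : Λ) :
    (a • f).toLin x = f.toLin (x * a) := rfl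

@[simp] theorem toLin_add (f g : DualModule R Λ E) (x : Λ) :
    (f + g).toLin x = f.toLin x + g.toLin x := rfl

instance : IsScalarTower R Λ (DualModule R Λ E) :=
  ⟨fun r a f ↦ ext fun x ↦ by
    rw [toLin_smul, mul_smul_comm, map_smul]; rfl⟩

/-- A linear form on a `Λ`-module induces a `Λ`-linear map to the dual module. -/
theorem exists_linearMap {X : Type*} [AddCommGroup X] [Module R X] [Module Λ X]
    [IsScalarTower R Λ X] (f : X →ₗ[R] E) :
    ∃ F : X →ₗ[Λ] DualModule R Λ E, ∀ x a, (F x).toLin a = f (a • x) :=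
  ⟨{ toFun := fun x ↦ f ∘ₗ (LinearMap.toSpanSingleton Λ X x).restrictScalars R
     map_add' := fun x y ↦ ext fun a ↦ (congrArg f (smul_add a x y)).trans (map_add f _ _)
     map_smul' := fun b x ↦ ext fun a ↦ congrArg f (mul_smul a b x).symm }, fun _ _ ↦ rfl⟩

/-- Λ-maps into the dual correspond to R-linear forms through evaluation at 1, so extension reduces
to the injectivity of E over R. -/
theorem injective (hE : IsDualizing R E) : Module.Injective Λ (DualModule R Λ E) := by
  refine ⟨fun A B _ _ _ _ f hf g ↦ ?_⟩
  have := hE.injective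
  let : Module R A := Module.compHom A (algebraMap R Λ)
  have : IsScalarTower R Λ A := IsScalarTower.of_algebraMap_smul fun _ _ ↦ rfl
  let : Module R B := Module.compHom B (algebraMap R Λ)
  have : IsScalarTower R Λ B := IsScalarTower.of_algebraMap_smul fun _ _ ↦ rfl
  let g' : A →ₗ[R] E :=
    { toFun := fun x ↦ (g x).toLin 1
      map_add' := fun x y ↦ by rw [map_add, toLin_add]
      map_smul' := fun r x ↦ by
        rw [← algebraMap_smul Λ r x, map_smul, toLin_smul, one_mul,
          Algebra.algebraMap_eq_smul_one, map_smul]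
        rfl }
  obtain ⟨h, hh⟩ := Module.Injective.out (f.restrictScalars R) hf g'
  obtain ⟨F, hF⟩ := exists_linearMap (Λ := Λ) h
  refine ⟨F, fun x ↦ ext fun a ↦ ?_⟩
  rw [hF, ← map_smul]
  refine (hh (a • x)).trans ?_
  change (g (a • x)).toLin 1 = _
  rw [map_smul, toLin_smul, one_mul]

theorem exists_apply_ne_zero (hE : IsDualizing R E) {X : Type u} [AddCommGroup X] [Module Λ X]
    (x : X) (hx : x ≠ 0) : ∃ F : X →ₗ[Λ] DualModule R Λ E, F x ≠ 0 := by
  let : Module R X := Module.compHom X (algebraMap R Λ)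
  have : IsScalarTower R Λ X := IsScalarTower.of_algebraMap_smul fun _ _ ↦ rfl
  obtain ⟨f, hf⟩ := hE.exists_apply_ne_zero X x hx
  obtain ⟨F, hF⟩ := exists_linearMap (Λ := Λ) f
  refine ⟨F, fun h ↦ hf ?_⟩
  have := hF x 1
  rw [h, one_smul] at this
  exact this.symm

variable [IsArtinianRing R] [Module.Finite R Λ]

theorem isFiniteLength_of_finite (X : Type*) [AddCommGroup X] [Module R X] [Module.Finite R X] :
    IsFiniteLength R X :=
  isFiniteLength_iff_isNoetherian_isArtinian.mpr ⟨inferInstance, inferInstance⟩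

theorem finite (hE : IsDualizing R E) : Module.Finite Λ (DualModule R Λ E) := by
  have h := hE.isFiniteLength_dual (isFiniteLength_of_finite (R := R) Λ)
  have := (isFiniteLength_iff_isNoetherian_isArtinian.mp h).1
  have : Module.Finite R (DualModule R Λ E) := inferInstanceAs (Module.Finite R (Λ →ₗ[R] E))
  exact Module.Finite.of_restrictScalars_finite R Λ _

/-- The action of `Λ` on its dual module by left multiplication on the argument. -/
def endOpHom : Λ →+* EndOp Λ (DualModule R Λ E) where
  toFun a := MulOpposite.op
    { toFun := fun f ↦ (f.toLin ∘ₗ LinearMap.mulLeft R a : Λ →ₗ[R] E)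
      map_add' := fun _ _ ↦ rfl
      map_smul' := fun b f ↦ ext fun x ↦ congrArg f.toLin (mul_assoc a x b) }
  map_one' := MulOpposite.unop_injective (LinearMap.ext fun f ↦ ext fun x ↦
    congrArg f.toLin (one_mul x))
  map_mul' a b := MulOpposite.unop_injective (LinearMap.ext fun f ↦ ext fun x ↦
    congrArg f.toLin (mul_assoc a b x))
  map_zero' := MulOpposite.unop_injective (LinearMap.ext fun f ↦ ext fun x ↦
    (congrArg f.toLin (zero_mul x)).trans (map_zero f.toLin))
  map_add' a b := MulOpposite.unop_injective (LinearMap.ext fun f ↦ ext fun x ↦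
    (congrArg f.toLin (add_mul a b x)).trans (map_add f.toLin _ _))

theorem endOpHom_bijective (hE : IsDualizing R E) :
    Function.Bijective (endOpHom : Λ →+* EndOp Λ (DualModule R Λ E)) := by
  constructor
  · refine (injective_iff_map_eq_zero _).mpr fun a ha ↦ ?_
    by_contra h0
    obtain ⟨f, hf⟩ := hE.exists_apply_ne_zero Λ a h0
    refine hf ?_
    have h : f (a * 1) = 0 :=
      LinearMap.congr_fun (LinearMap.congr_fun (congrArg MulOpposite.unop ha) f :) 1
    rwa [mul_one] at h
  · intro φ
    -- The form sending f to φ(f)(1) is evaluation at some a by duality; applied to x • f, it gives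
    -- φ(f)(x) = f(ax).
    let ev : (Λ →ₗ[R] E) →ₗ[R] E :=
      { toFun := fun f ↦ (φ.unop f : DualModule R Λ E).toLin 1
        map_add' := fun f g ↦ congrArg (fun h : DualModule R Λ E ↦ h.toLin 1)
          (φ.unop.map_add (f : DualModule R Λ E) g)
        map_smul' := fun r f ↦ congrArg (fun h : DualModule R Λ E ↦ h.toLin 1)
          (φ.unop.map_smul_of_tower r (f : DualModule R Λ E)) }
    obtain ⟨a, ha⟩ := hE.exists_apply_eq (isFiniteLength_of_finite (R := R) Λ) ev
    refine ⟨a, MulOpposite.unop_injective (LinearMap.ext fun f ↦ ext fun x ↦ ?_)⟩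
    have h := ha (x • f : DualModule R Λ E)
    change ((φ.unop (x • f)) : DualModule R Λ E).toLin 1 = f.toLin (a * x) at h
    rw [map_smul, toLin_smul, one_mul] at h
    exact h.symm

end DualModule

/-- A map with minimal kernel is injective, as one more coordinate would shrink a nonzero kernel. At
least one copy of W is kept so that the later matrix ring has positive size. -/
theorem exists_injective_linearMap_pi {Λ W : Type u} [Ring Λ] [IsArtinianRing Λ] [AddCommGroup W]
    [Module Λ W] (hW : ∀ (X : Type u) [AddCommGroup X] [Module Λ X] (x : X), x ≠ 0 →
      ∃ F : X →ₗ[Λ] W, F x ≠ 0)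
    (X : Type u) [AddCommGroup X] [Module Λ X] [Module.Finite Λ X] :
    ∃ (k : ℕ) (f : X →ₗ[Λ] (Fin (k + 1) → W)), Function.Injective f := by
  obtain ⟨K, ⟨k, f, rfl⟩, hmin⟩ := IsArtinian.set_has_minimal
    {K : Submodule Λ X | ∃ (k : ℕ) (f : X →ₗ[Λ] (Fin (k + 1) → W)), LinearMap.ker f = K}
    ⟨_, 0, 0, rfl⟩
  refine ⟨k, f, LinearMap.ker_eq_bot.mp ?_⟩
  by_contra hne
  obtain ⟨x, hx, hx0⟩ := Submodule.exists_mem_ne_zero_of_ne_bot hne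
  obtain ⟨F, hF⟩ := hW X x hx0
  let f' : X →ₗ[Λ] (Fin (k + 1 + 1) → W) :=
    LinearMap.pi (Fin.cons F fun i ↦ LinearMap.proj i ∘ₗ f)
  refine hmin _ ⟨k + 1, f', rfl⟩ (lt_of_le_of_ne (fun y hy ↦ ?_) fun h ↦ hF ?_)
  · refine LinearMap.mem_ker.mpr (funext fun i ↦ ?_)
    exact congrFun (LinearMap.mem_ker.mp hy) i.succ
  · rw [← h] at hx
    exact congrFun (LinearMap.mem_ker.mp hx) 0

/-- An artin algebra has a finitely generated injective cogenerator whose endomorphism ring,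
acting from the right, is the algebra itself. -/
theorem IsArtinAlgebra.exists_injective_cogenerator {Λ : Type u} [Ring Λ] (hΛ : IsArtinAlgebra Λ) :
    ∃ (W : Type u) (_ : AddCommGroup W) (_ : Module Λ W), Module.Finite Λ W ∧
      Module.Injective Λ W ∧ Nonempty (EndOp Λ W ≃+* Λ) ∧
      ∀ (X : Type u) [AddCommGroup X] [Module Λ X] [Module.Finite Λ X],
        ∃ (k : ℕ) (f : X →ₗ[Λ] (Fin (k + 1) → W)), Function.Injective f := by
  have := hΛ.isArtinianRing
  obtain ⟨R, _, _, _, _⟩ := hΛ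
  obtain ⟨E, _, _, hE⟩ := exists_isDualizing R
  exact ⟨DualModule R Λ E, inferInstance, inferInstance, DualModule.finite hE,
    DualModule.injective hE,
    ⟨(RingEquiv.ofBijective _ (DualModule.endOpHom_bijective hE)).symm⟩,
    exists_injective_linearMap_pi fun X _ _ x hx ↦ DualModule.exists_apply_ne_zero hE x hx⟩

end DualModule

/-! ### The functor Hom(L, -) to modules over the endomorphism ring -/

section HomModule

variable (Λ L Q Q' : Type u) [Ring Λ] [AddCommGroup L] [Module Λ L] [AddCommGroup Q] [Module Λ Q]
  [AddCommGroup Q'] [Module Λ Q']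

/-- The `Λ`-linear maps from `L` to `Q`, as a left module over the ring of endomorphisms of `L`
acting from the right. -/
def HomModule : Type u := L →ₗ[Λ] Q

namespace HomModule

instance : AddCommGroup (HomModule Λ L Q) := inferInstanceAs (AddCommGroup (L →ₗ[Λ] Q))

variable {Λ L Q Q'}

/-- The linear map underlying an element of the module of homomorphisms. -/
def toLin (f : HomModule Λ L Q) : L →ₗ[Λ] Q := f

/-- A linear map as an element of the module of homomorphisms. -/
def ofLin (f : L →ₗ[Λ] Q) : HomModule Λ L Q := f

@[ext]
theorem ext {f g : HomModule Λ L Q} (h : ∀ x, f.toLin x = g.toLin x) : f = g :=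
  LinearMap.ext h

instance : Module (EndOp Λ L) (HomModule Λ L Q) where
  smul c f := f.toLin ∘ₗ c.unop
  one_smul _ := rfl
  mul_smul _ _ _ := rfl
  smul_zero _ := rfl
  smul_add _ _ _ := rfl
  add_smul _ _ f := ext fun _ ↦ map_add f.toLin _ _
  zero_smul f := ext fun _ ↦ map_zero f.toLin

@[simp] theorem toLin_smul (c : EndOp Λ L) (f : HomModule Λ L Q) (x : L) :
    (c • f).toLin x = f.toLin (c.unop x) := rfl

@[simp] theorem toLin_add (f g : HomModule Λ L Q) (x : L) :
    (f + g).toLin x = f.toLin x + g.toLin x := rfl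

@[simp] theorem toLin_zero (x : L) : (0 : HomModule Λ L Q).toLin x = 0 := rfl

@[simp] theorem toLin_sum {κ : Type*} (s : Finset κ) (f : κ → HomModule Λ L Q) (x : L) :
    (∑ i ∈ s, f i).toLin x = ∑ i ∈ s, (f i).toLin x :=
  LinearMap.sum_apply s f x

/-- Composition with a linear map. -/
def map (φ : Q →ₗ[Λ] Q') : HomModule Λ L Q →ₗ[EndOp Λ L] HomModule Λ L Q' where
  toFun f := ofLin (φ ∘ₗ f.toLin)
  map_add' _ _ := ext fun _ ↦ map_add φ _ _
  map_smul' _ _ := rfl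

@[simp] theorem toLin_map (φ : Q →ₗ[Λ] Q') (f : HomModule Λ L Q) (x : L) :
    (map φ f).toLin x = φ (f.toLin x) := rfl

variable (Λ L) in
/-- The regular module is the module of homomorphisms from `L` to itself. -/
def selfEquiv : EndOp Λ L ≃ₗ[EndOp Λ L] HomModule Λ L L where
  toFun c := ofLin c.unop
  invFun f := MulOpposite.op f.toLin
  map_add' _ _ := rfl
  map_smul' _ _ := rfl
  left_inv _ := rfl
  right_inv _ := rfl

theorem projective (h : IsInAdd Λ Q L) : Module.Projective (EndOp Λ L) (HomModule Λ L Q) := by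
  obtain ⟨κ, _, f, g, hfg⟩ := h
  let s : HomModule Λ L Q →ₗ[EndOp Λ L] (κ → EndOp Λ L) :=
    LinearMap.pi fun i ↦ (selfEquiv Λ L).symm.toLinearMap ∘ₗ map (f i)
  let r : (κ → EndOp Λ L) →ₗ[EndOp Λ L] HomModule Λ L Q :=
    ∑ i, map (g i) ∘ₗ (selfEquiv Λ L).toLinearMap ∘ₗ LinearMap.proj i
  refine Module.Projective.of_split s r (LinearMap.ext fun h ↦ ext fun x ↦ ?_)
  have := LinearMap.congr_fun hfg (h.toLin x)
  simpa [r, s] using this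

theorem map_exact {L' : Type u} [AddCommGroup L'] [Module Λ L'] (j : L' →ₗ[Λ] Q) (d : Q →ₗ[Λ] Q')
    (hj : Function.Injective j) (h : Function.Exact j d) :
    Function.Exact (map j : HomModule Λ L L' →ₗ[EndOp Λ L] _) (map d) := by
  intro f
  constructor
  · intro hf
    have hf' (x : L) : f.toLin x ∈ LinearMap.range j :=
      (h _).mp (congrArg (fun g ↦ g.toLin x) hf)
    refine ⟨ofLin ((LinearEquiv.ofInjective j hj).symm.toLinearMap ∘ₗ
      f.toLin.codRestrict _ hf'), ext fun x ↦ ?_⟩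
    exact congrArg Subtype.val ((LinearEquiv.ofInjective j hj).apply_symm_apply ⟨f.toLin x, hf' x⟩)
  · rintro ⟨g, rfl⟩
    exact ext fun x ↦ (h _).mpr ⟨_, rfl⟩

theorem map_injective {j : Q →ₗ[Λ] Q'} (hj : Function.Injective j) :
    Function.Injective (map j : HomModule Λ L Q →ₗ[EndOp Λ L] _) :=
  fun _ _ h ↦ ext fun x ↦ hj (congrArg (fun g ↦ g.toLin x) h)

/-! ### Hom(L, -) when Λ is a direct summand of L -/

section Generator

variable (b : L →ₗ[Λ] Λ)

/-- The homomorphism `l ↦ b l • q`. -/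
def rankOne (q : Q) : HomModule Λ L Q := ofLin ((LinearMap.toSpanSingleton Λ Q q) ∘ₗ b)

@[simp] theorem toLin_rankOne (q : Q) (x : L) : (rankOne b q).toLin x = b x • q := rfl

/-- The endomorphism `x ↦ b x • l`. -/
def rankOneEnd (l : L) : EndOp Λ L := (selfEquiv Λ L).symm (rankOne b l)

@[simp] theorem unop_rankOneEnd (l x : L) : (rankOneEnd b l).unop x = b x • l := rfl

theorem rankOneEnd_smul_eq (l : L) (f : HomModule Λ L Q) :
    rankOneEnd b l • f = rankOne b (f.toLin l) :=
  ext fun x ↦ by simp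

variable {b} {e : L} (he : b e = 1)

-- If f(l) ≠ 0, essentiality gives a nonzero a • f(l) = d q. The rank-one map of q then composes
-- with d to a multiple of f, nonzero at e.
include he in
theorem map_range_essential (d : Q →ₗ[Λ] Q') (hd : IsEssentialSubmodule (LinearMap.range d)) :
    IsEssentialSubmodule
      (LinearMap.range (map d : HomModule Λ L Q →ₗ[EndOp Λ L] HomModule Λ L Q')) := by
  intro V hV
  refine eq_bot_iff.mpr fun f hf ↦ ext fun l ↦ ?_
  by_contra hl
  have hne : Submodule.span Λ {f.toLin l} ≠ ⊥ := fun h ↦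
    hl (Submodule.span_singleton_eq_bot.mp h)
  obtain ⟨y, ⟨⟨q, rfl⟩, hy⟩, hy0⟩ := Submodule.exists_mem_ne_zero_of_ne_bot (mt (hd _) hne)
  obtain ⟨a, ha⟩ := Submodule.mem_span_singleton.mp hy
  have h1 : map d (rankOne b q) = rankOneEnd b (a • l) • f := by
    rw [rankOneEnd_smul_eq, map_smul, ha]
    exact ext fun x ↦ by simp
  have h2 : map d (rankOne b q) ∈ (⊥ : Submodule (EndOp Λ L) (HomModule Λ L Q')) :=
    hV ▸ ⟨⟨_, rfl⟩, h1 ▸ V.smul_mem _ hf⟩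
  have h3 := congrArg (fun g ↦ g.toLin e) ((Submodule.mem_bot _).mp h2)
  simp only [toLin_map, toLin_rankOne, he, one_smul, toLin_zero] at h3
  exact hy0 h3

variable (Λ L Q) in
/-- Composition as a ring homomorphism. -/
def mapRingHom : Module.End Λ Q →+* Module.End (EndOp Λ L) (HomModule Λ L Q) where
  toFun := map
  map_one' := rfl
  map_mul' _ _ := rfl
  map_zero' := rfl
  map_add' _ _ := rfl

-- Rank-one endomorphisms move any value to e: Φ(f)(l) is the value at e of Φ on the rank-one map of
-- f(l). So Φ is composition with the map of Q read off at e.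
include he in
theorem mapRingHom_bijective : Function.Bijective (mapRingHom Λ L Q) := by
  constructor
  · refine fun φ ψ h ↦ LinearMap.ext fun q ↦ ?_
    have := congrArg (fun g ↦ g.toLin e) (LinearMap.congr_fun h (rankOne b q))
    change φ (b e • q) = ψ (b e • q) at this
    rwa [he, one_smul] at this
  · intro Φ
    have hΦ (l : L) (f : HomModule Λ L Q) :
        (Φ f).toLin l = (Φ (rankOne b (f.toLin l))).toLin e := by
      rw [← rankOneEnd_smul_eq, map_smul, toLin_smul, unop_rankOneEnd, he, one_smul]
    refine ⟨{ toFun := fun q ↦ (Φ (rankOne b q)).toLin e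
              map_add' := fun q q' ↦ ?_
              map_smul' := fun a q ↦ ?_ }, LinearMap.ext fun f ↦ ext fun l ↦ (hΦ l f).symm⟩
    · have h : rankOne b (q + q') = rankOne b q + rankOne b q' := ext fun x ↦ smul_add _ _ _
      rw [h, map_add, toLin_add]
    · have := hΦ (a • e) (rankOne b q)
      rw [toLin_rankOne, map_smul, map_smul, he, smul_eq_mul, mul_one] at this
      exact this.symm

/-- The additive group `ε • A`, where `ε` is the idempotent `x ↦ b x • e`. -/
def corner (b : L →ₗ[Λ] Λ) (e : L) (A : Type u) [AddCommGroup A] [Module (EndOp Λ L) A] :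
    AddSubgroup A where
  carrier := {x | rankOneEnd b e • x = x}
  add_mem' {_ _} hx hy := by
    change _ = _
    rw [smul_add, hx, hy]
  zero_mem' := smul_zero _
  neg_mem' {_} hx := by
    change _ = _
    rw [smul_neg, hx]

include he in
theorem rankOneEnd_mul (l : L) (a : Λ) :
    rankOneEnd b (a • e) * rankOneEnd b l = rankOneEnd b (a • l) :=
  MulOpposite.unop_injective (LinearMap.ext fun x ↦ by simp [he])

variable (A : Type u) [AddCommGroup A] [Module (EndOp Λ L) A]

include he in
theorem rankOneEnd_smul_mem_corner (l : L) (x : A) : rankOneEnd b l • x ∈ corner b e A := by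
  have := rankOneEnd_mul he l 1
  rw [one_smul, one_smul] at this
  change _ = _
  rw [← mul_smul, this]

theorem rankOneEnd_add (l l' : L) :
    rankOneEnd b (l + l') = rankOneEnd b l + rankOneEnd b l' :=
  MulOpposite.unop_injective (LinearMap.ext fun _ ↦ smul_add _ _ _)

/-- The corner `ε • A` as a `Λ`-module. -/
abbrev cornerModule : Module Λ (corner b e A) where
  smul a x := ⟨rankOneEnd b (a • e) • x.1, rankOneEnd_smul_mem_corner he A _ _⟩
  one_smul x := Subtype.ext <| by
    change rankOneEnd b ((1 : Λ) • e) • x.1 = _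
    rw [one_smul]
    exact x.2
  mul_smul a a' x := Subtype.ext <| by
    change rankOneEnd b ((a * a') • e) • x.1 = rankOneEnd b (a • e) • rankOneEnd b (a' • e) • x.1
    rw [← mul_smul, rankOneEnd_mul he, mul_smul]
  smul_zero a := Subtype.ext (smul_zero _)
  smul_add a x y := Subtype.ext (smul_add _ _ _)
  add_smul a a' x := Subtype.ext <| by
    change rankOneEnd b ((a + a') • e) • x.1 = rankOneEnd b (a • e) • x.1 + _
    rw [add_smul, rankOneEnd_add, add_smul]
    rfl
  zero_smul x := Subtype.ext <| by
    change rankOneEnd b ((0 : Λ) • e) • x.1 = 0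
    rw [zero_smul, show rankOneEnd b 0 = 0 from
      MulOpposite.unop_injective (LinearMap.ext fun _ ↦ smul_zero _), zero_smul]

-- Hom(L, -) is right adjoint to the exact functor A ↦ εA. A map on B is recovered from its
-- restriction ψ to the corner by sending y and l to ψ applied to `rankOneEnd b l • y`.
include he in
theorem injective (hQ : Module.Injective Λ Q) :
    Module.Injective (EndOp Λ L) (HomModule Λ L Q) := by
  refine ⟨fun A B _ _ _ _ f hf g ↦ ?_⟩
  let : Module Λ (corner b e A) := cornerModule he A
  let : Module Λ (corner b e B) := cornerModule he B
  let f₀ : corner b e A →ₗ[Λ] corner b e B :=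
    { toFun := fun x ↦ ⟨f x, by
        change _ = _
        rw [← map_smul]
        exact congrArg f x.2⟩
      map_add' := fun x y ↦ Subtype.ext (map_add f _ _)
      map_smul' := fun a x ↦ Subtype.ext (map_smul f (rankOneEnd b (a • e)) x.1) }
  have hf₀ : Function.Injective f₀ := fun x y h ↦ Subtype.ext (hf (congrArg Subtype.val h))
  let g₀ : corner b e A →ₗ[Λ] Q :=
    { toFun := fun x ↦ (g x).toLin e
      map_add' := fun x y ↦ by
        rw [AddSubgroup.coe_add, map_add, toLin_add]
      map_smul' := fun a x ↦ by
        change (g (rankOneEnd b (a • e) • x.1)).toLin e = a • (g x).toLin e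
        rw [map_smul, toLin_smul, unop_rankOneEnd, he, one_smul, map_smul] }
  obtain ⟨ψ, hψ⟩ := Module.Injective.out f₀ hf₀ g₀
  refine ⟨{ toFun := fun y ↦ ofLin
              { toFun := fun l ↦ ψ ⟨rankOneEnd b l • y, rankOneEnd_smul_mem_corner he B l y⟩
                map_add' := fun l l' ↦ ?_
                map_smul' := fun a l ↦ ?_ }
            map_add' := fun y y' ↦ ext fun l ↦ ?_
            map_smul' := fun c y ↦ ext fun l ↦ ?_ }, fun x ↦ ext fun l ↦ ?_⟩
  · rw [← map_add]
    congr 1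
    exact Subtype.ext (by
      change rankOneEnd b (l + l') • y = rankOneEnd b l • y + rankOneEnd b l' • y
      rw [rankOneEnd_add, add_smul])
  · rw [RingHom.id_apply, ← map_smul]
    congr 1
    exact Subtype.ext (by
      change rankOneEnd b (a • l) • y = rankOneEnd b (a • e) • rankOneEnd b l • y
      rw [← mul_smul, rankOneEnd_mul he])
  · rw [toLin_add]
    change ψ _ = ψ _ + ψ _
    rw [← map_add]
    congr 1
    exact Subtype.ext (smul_add _ _ _)
  · rw [toLin_smul]
    change ψ _ = ψ _
    congr 1
    exact Subtype.ext (by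
      change rankOneEnd b l • c • y = rankOneEnd b (c.unop l) • y
      rw [← mul_smul]
      congr 1
      exact MulOpposite.unop_injective (LinearMap.ext fun x ↦ map_smul c.unop _ _))
  · have h1 := hψ ⟨rankOneEnd b l • x, rankOneEnd_smul_mem_corner he A l x⟩
    change ψ ⟨f (rankOneEnd b l • x), _⟩ = (g (rankOneEnd b l • x)).toLin e at h1
    rw [map_smul g, toLin_smul, unop_rankOneEnd, he, one_smul] at h1
    refine Eq.trans ?_ h1
    change ψ _ = ψ _
    congr 1
    exact Subtype.ext (map_smul f _ _).symm

end Generator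

end HomModule

end HomModule

/-! ### Extending minimal injective copresentations -/

section MinimalInjectiveResolution

variable {Γ : Type u} [Ring Γ]

theorem isEssentialSubmodule_range_comp_mkQ {X Q : Type u} [AddCommGroup X] [Module Γ X]
    [AddCommGroup Q] [Module Γ Q] {K : Submodule Γ X} {ι : (X ⧸ K) →ₗ[Γ] Q}
    (h : IsEssentialSubmodule (LinearMap.range ι)) :
    IsEssentialSubmodule (LinearMap.range (ι ∘ₗ K.mkQ)) := by
  rwa [LinearMap.range_comp_of_range_eq_top ι K.range_mkQ]

theorem exact_comp_mkQ {A X Q : Type u} [AddCommGroup A] [Module Γ A] [AddCommGroup X] [Module Γ X]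
    [AddCommGroup Q] [Module Γ Q] (d : A →ₗ[Γ] X) {ι : (X ⧸ LinearMap.range d) →ₗ[Γ] Q}
    (h : Function.Injective ι) : Function.Exact d (ι ∘ₗ (LinearMap.range d).mkQ) := fun x ↦ by
  rw [LinearMap.comp_apply, map_eq_zero_iff ι h, Submodule.mkQ_apply,
    Submodule.Quotient.mk_eq_zero]
  rfl

theorem exists_next_injective {A X : Type u} [AddCommGroup A] [Module Γ A] [AddCommGroup X]
    [Module Γ X] (d : A →ₗ[Γ] X) :
    ∃ (Y : ModuleCat.{u} Γ) (d' : X →ₗ[Γ] Y), Module.Injective Γ Y ∧ Function.Exact d d' ∧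
      IsEssentialSubmodule (LinearMap.range d') := by
  obtain ⟨Q, _, _, ι, hQ, hι, hess⟩ := exists_injective_hull (Γ := Γ) (X ⧸ LinearMap.range d)
  exact ⟨ModuleCat.of Γ Q, ι ∘ₗ (LinearMap.range d).mkQ, hQ, exact_comp_mkQ d hι,
    isEssentialSubmodule_range_comp_mkQ hess⟩

/-- The beginning of a minimal injective resolution extends to a minimal injective resolution. -/
theorem exists_minimalInjectiveResolution {I₀ I₁ : Type u} [AddCommGroup I₀] [Module Γ I₀]
    [AddCommGroup I₁] [Module Γ I₁] (h₀ : Module.Injective Γ I₀) (h₁ : Module.Injective Γ I₁)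
    (ι : Γ →ₗ[Γ] I₀) (d : I₀ →ₗ[Γ] I₁) (hι : Function.Injective ι) (hexact : Function.Exact ι d)
    (hess₀ : IsEssentialSubmodule (LinearMap.range ι))
    (hess₁ : IsEssentialSubmodule (LinearMap.range d)) :
    ∃ E : MinimalInjectiveResolution Γ, Nonempty (I₀ ≃ₗ[Γ] E.I 0) ∧ Nonempty (I₁ ≃ₗ[Γ] E.I 1) := by
  choose next dnext hinj hex hess using
    fun s : (X Y : ModuleCat.{u} Γ) × (X →ₗ[Γ] Y) ↦ exists_next_injective s.2.2
  let σ (n : ℕ) : (X Y : ModuleCat.{u} Γ) × (X →ₗ[Γ] Y) :=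
    Nat.rec ⟨ModuleCat.of Γ I₀, ModuleCat.of Γ I₁, d⟩ (fun _ s ↦ ⟨s.2.1, next s, dnext s⟩) n
  refine ⟨{ I := fun n ↦ (σ n).1
            ι := ι
            d := fun n ↦ (σ n).2.2
            injective := fun n ↦ ?_
            ι_injective := hι
            exact_zero := hexact
            exact_succ := fun n ↦ hex (σ n)
            essential_zero := hess₀
            essential_succ := fun n ↦ ?_ }, ⟨.refl Γ I₀⟩, ⟨.refl Γ I₁⟩⟩
  · match n with
    | 0 => exact h₀
    | 1 => exact h₁
    | n + 2 => exact hinj (σ n)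
  · match n with
    | 0 => exact hess₁
    | n + 1 => exact hess (σ n)

theorem two_le_dominantDimension (E : MinimalInjectiveResolution Γ)
    (h₀ : Module.Projective Γ (E.I 0)) (h₁ : Module.Projective Γ (E.I 1)) :
    2 ≤ E.dominantDimension := by
  refine le_iInf₂ fun i hi ↦ ?_
  match i with
  | 0 => exact absurd h₀ hi
  | 1 => exact absurd h₁ hi
  | i + 2 => exact_mod_cast Nat.le_add_left 2 i

end MinimalInjectiveResolution

/-! ### Morita equivalence with matrix rings -/

section Morita

theorem IsMoritaEquivalent.of_ringEquiv_int {A B : Type u} [Ring A] [Ring B] [Algebra ℤ A]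
    [Algebra ℤ B] (e : A ≃+* B) : IsMoritaEquivalent ℤ A B :=
  .of_algEquiv ℤ (AlgEquiv.ofRingEquiv (f := e) fun r ↦ RingHom.congr_fun
    (RingHom.ext_int (e.toRingHom.comp (algebraMap ℤ A)) (algebraMap ℤ B)) r)

theorem isMoritaEquivalent_endOp_pi {Λ W : Type u} [Ring Λ] [AddCommGroup W] [Module Λ W]
    (e : EndOp Λ W ≃+* Λ) (k : ℕ) {A : Type u} [Ring A] [Algebra ℤ A]
    (e' : A ≃+* EndOp Λ (Fin (k + 1) → W)) : IsMoritaEquivalent ℤ A Λ := by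
  let e₁ : EndOp Λ (Fin (k + 1) → W) ≃+* Matrix (Fin (k + 1)) (Fin (k + 1)) Λ :=
    ((endVecRingEquivMatrixEnd (Fin (k + 1)) Λ W).op.trans
      RingEquiv.mopMatrix.symm).trans e.mapMatrix
  exact IsMoritaEquivalent.trans ℤ (.of_ringEquiv_int (e'.trans e₁))
    (.symm ℤ (.matrix (ι := Fin (k + 1)) Λ ℤ))

end Morita

/-! ### Finiteness of the representation dimension -/

section RepresentationDimension

variable {Λ : Type u} [Ring Λ]

theorem repDim_lt_top_of_isRadicalFiltration {L Q₁ W : Type u} [AddCommGroup L] [Module Λ L]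
    [AddCommGroup Q₁] [Module Λ Q₁] [AddCommGroup W] [Module Λ W] [Module.Finite Λ L]
    (hΛ : IsArtinAlgebra Λ) {U : ℕ → ModuleCat.{u} Λ} {m : ℕ} (hL : IsRadicalFiltration L U m)
    (b : L →ₗ[Λ] Λ) {e : L} (he : b e = 1) (eW : EndOp Λ W ≃+* Λ) (k : ℕ)
    (hQ₀ : Module.Injective Λ (Fin (k + 1) → W)) (hQ₁ : Module.Injective Λ Q₁)
    (hadd₀ : IsInAdd Λ (Fin (k + 1) → W) L) (hadd₁ : IsInAdd Λ Q₁ L)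
    (j : L →ₗ[Λ] (Fin (k + 1) → W)) (d : (Fin (k + 1) → W) →ₗ[Λ] Q₁) (hj : Function.Injective j)
    (hjd : Function.Exact j d) (hess₀ : IsEssentialSubmodule (LinearMap.range j))
    (hess₁ : IsEssentialSubmodule (LinearMap.range d)) : repDim Λ < ⊤ := by
  have hΓ := hΛ.endOp L
  have := hΓ.isArtinianRing
  let ι : EndOp Λ L →ₗ[EndOp Λ L] HomModule Λ L (Fin (k + 1) → W) :=
    HomModule.map j ∘ₗ (HomModule.selfEquiv Λ L).toLinearMap
  obtain ⟨E, ⟨e₀⟩, ⟨e₁⟩⟩ := exists_minimalInjectiveResolution (HomModule.injective he hQ₀)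
    (HomModule.injective he hQ₁) ι (HomModule.map d)
    ((HomModule.map_injective hj).comp (HomModule.selfEquiv Λ L).injective)
    (fun x ↦ by
      rw [HomModule.map_exact j d hj hjd x, LinearMap.coe_comp, LinearEquiv.coe_coe,
        (HomModule.selfEquiv Λ L).surjective.range_comp])
    (by
      rw [LinearMap.range_comp_of_range_eq_top _ (LinearEquiv.range _)]
      exact HomModule.map_range_essential he j hess₀)
    (HomModule.map_range_essential he d hess₁)
  refine lt_of_le_of_lt (sInf_le ⟨EndOp Λ L, inferInstance, E, hΓ, ?_, ?_, rfl⟩)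
    hL.isProjectiveHeredityChain.globalDimension_lt_top
  · exact two_le_dominantDimension E
      (have := HomModule.projective hadd₀; .of_equiv e₀)
      (have := HomModule.projective hadd₁; .of_equiv e₁)
  · exact isMoritaEquivalent_endOp_pi eW k
      (RingEquiv.op (e₀.symm.conjRingEquiv.trans (RingEquiv.ofBijective _ (HomModule.mapRingHom_bijective he)).symm))

theorem isInAdd_pi {W : Type u} [AddCommGroup W] [Module Λ W] (k : ℕ) :
    IsInAdd Λ (Fin k → W) W :=
  ⟨Fin k, inferInstance, LinearMap.proj, LinearMap.single Λ (fun _ ↦ W),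
    by ext x i; simp [Finset.sum_apply, Pi.single_apply]⟩

theorem isInAdd_of_isCompl {X : Type u} [AddCommGroup X] [Module Λ X] {A B : Submodule Λ X}
    (h : IsCompl A B) : IsInAdd Λ A X :=
  .of_retract A.subtype (A.projectionOnto B h) (by ext; simp)

/-- If `X` is essential in a summand of `Q`, then adding the complement makes it essential. -/
theorem essential_coprod_subtype {X Q : Type u} [AddCommGroup X] [Module Λ X] [AddCommGroup Q]
    [Module Λ Q] {E C : Submodule Λ Q} (hEC : IsCompl E C) (ι : X →ₗ[Λ] E)
    (hι : Function.Injective ι) (hess : IsEssentialSubmodule (LinearMap.range ι)) :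
    Function.Injective ((E.subtype ∘ₗ ι).coprod C.subtype) ∧
      IsEssentialSubmodule (LinearMap.range ((E.subtype ∘ₗ ι).coprod C.subtype)) := by
  constructor
  · refine (injective_iff_map_eq_zero _).mpr fun ⟨x, c⟩ h ↦ ?_
    have h' : (ι x : Q) + c = 0 := h
    have hc : (c : Q) = 0 := Submodule.disjoint_def.mp hEC.disjoint _
      (by rw [← neg_eq_of_add_eq_zero_right h']; exact neg_mem (ι x).2) c.2
    rw [hc, add_zero] at h'
    exact Prod.ext (hι ((Subtype.ext h').trans (map_zero ι).symm)) (Subtype.ext hc)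
  · intro V hV
    have hmem (v : Q) (hv : v ∈ V)
        -- The enlarged image contains C, so membership in it depends only on the component in E.
        (h : E.projectionOnto C hEC v ∈ LinearMap.range ι) : v = 0 := by
      obtain ⟨x, hx⟩ := h
      have hvr : v ∈ LinearMap.range ((E.subtype ∘ₗ ι).coprod C.subtype) ⊓ V := by
        refine ⟨⟨(x, C.projectionOnto E hEC.symm v), ?_⟩, hv⟩
        change (ι x : Q) + (C.projectionOnto E hEC.symm v : Q) = v
        rw [hx]
        exact Submodule.projection_add_projection_eq_self hEC v
      rwa [hV, Submodule.mem_bot] at hvr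
    have hmap : V.map (E.projectionOnto C hEC) = ⊥ := by
      refine hess _ (eq_bot_iff.mpr ?_)
      rintro _ ⟨hr, v, hv, rfl⟩
      rw [hmem v hv hr, map_zero]
      exact zero_mem _
    refine eq_bot_iff.mpr fun v hv ↦ hmem v hv ?_
    have : E.projectionOnto C hEC v ∈ V.map (E.projectionOnto C hEC) := ⟨v, hv, rfl⟩
    rw [hmap, Submodule.mem_bot] at this
    rw [this]
    exact zero_mem _

theorem IsArtinAlgebra.repDim_lt_top (hΛ : IsArtinAlgebra Λ) : repDim Λ < ⊤ := by
  have := hΛ.isArtinianRing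
  obtain ⟨W, _, _, _, hW, ⟨eW⟩, hcog⟩ := hΛ.exists_injective_cogenerator
  obtain ⟨N, _, _, _, -, U, m, hL⟩ := exists_isRadicalFiltration
    (fun X _ _ _ ↦ (hΛ.endOp X).isArtinianRing) (Λ × W)
  obtain ⟨k, f, hf⟩ := hcog ((Λ × W) × N)
  have hQ₀ : Module.Injective Λ (Fin (k + 1) → W) := inferInstance
  obtain ⟨E, C, ι, hEC, -, hι, hess, -⟩ := exists_essential_summand f hf
  -- Replacing L by L × C makes the whole power of W its injective hull, so that the endomorphism
  -- ring of the hull is exactly a matrix ring over Λ.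
  obtain ⟨hj, hjess⟩ := essential_coprod_subtype hEC ι hι hess
  set j := (E.subtype ∘ₗ ι).coprod C.subtype
  have hWadd : IsInAdd Λ W ((Λ × W) × N) :=
    .of_retract (LinearMap.inl Λ (Λ × W) N ∘ₗ LinearMap.inr Λ Λ W)
      (LinearMap.snd Λ Λ W ∘ₗ LinearMap.fst Λ (Λ × W) N) (by ext; simp)
  have hC : IsInAdd Λ C ((Λ × W) × N) :=
    (isInAdd_of_isCompl hEC.symm).trans ((isInAdd_pi _).trans hWadd)
  have hWadd' : IsInAdd Λ W (((Λ × W) × N) × C) := hWadd.trans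
    (.of_retract (LinearMap.inl Λ _ _) (LinearMap.fst Λ _ _) (by ext <;> simp))
  -- The second term is the hull of the cokernel of j; being a summand of a power of W, it lies in
  -- add L.
  obtain ⟨k₁, f₁, hf₁⟩ := hcog ((Fin (k + 1) → W) ⧸ LinearMap.range j)
  obtain ⟨E₁, C₁, ι₁, hEC₁, -, hι₁, hess₁, hE₁⟩ := exists_essential_summand f₁ hf₁
  exact repDim_lt_top_of_isRadicalFiltration hΛ (hL.prod hC)
    (LinearMap.fst Λ Λ W ∘ₗ LinearMap.fst Λ _ _ ∘ₗ LinearMap.fst Λ _ _) (e := (((1, 0), 0), 0)) rfl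
    eW k hQ₀ hE₁ ((isInAdd_pi _).trans hWadd')
    ((isInAdd_of_isCompl hEC₁).trans ((isInAdd_pi _).trans hWadd')) j
    (ι₁ ∘ₗ (LinearMap.range j).mkQ) hj (exact_comp_mkQ j hι₁) hjess
    (isEssentialSubmodule_range_comp_mkQ hess₁)

end RepresentationDimension

theorem mainTheorem1 (Λ : Type u) [Ring Λ] (hΛ : IsArtinAlgebra Λ) :
    (∀ (M : Type v) [AddCommGroup M] [Module Λ M] [Module.Finite Λ M],
      ∃ (N : Type v) (_ : AddCommGroup N) (_ : Module Λ N), Module.Finite Λ N ∧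
        IsQuasiHereditary (Module.End Λ (M × N))ᵐᵒᵖ) ∧
    repDim Λ < ⊤ :=
  ⟨fun M _ _ _ ↦ exists_isQuasiHereditary_endOp hΛ M, hΛ.repDim_lt_top⟩
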